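/- Let $F_n$ be the free group of rank $n$. A subgroup $A\le F_n$ is a free factor if $F_n=A*B$ for some subgroup $B\le F_n$. Let $\mathcal{AF}_n$ be the simplicial complex whose vertices are the non-trivial proper free factors of $F_n$ and whose simplices are the non-empty finite sets of such factors that are totally ordered by inclusion, and let $\mathcal{OF}_n$ be the simplicial complex whose vertices are the conjugacy classes of non-trivial proper free factors of $F_n$ and whose simplices are the non-empty finite chains for the order in which $[A]\le[B]$ if some conjugate of $A$ is contained in $B$. The rank of a vertex is the rank of the corresponding free factor. Then, for every $n$: 1. every simplicial automorphism of $\mathcal{AF}_n$ maps the set of vertices of rank $i$ onto itself, for each $i=1,\dots,n-1$; 2. every simplicial automorphism of $\mathcal{OF}_n$ maps the set of vertices of rank $i$ onto itself, for each $i=1,\dots,n-1$. -/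

import Mathlib

/-! ### Simplicial complexes attached to ordered sets, and their automorphisms -/

/-- The order complex (the simplicial complex underlying the geometric realisation) of an ordered
set `P`: its vertices are the elements of `P`, and its simplices are the non-empty finite
chains. -/
def orderComplex (P : Type*) [Preorder P] : AbstractSimplicialComplex P where
  faces := {s | s.Nonempty ∧ IsChain (· ≤ ·) (s : Set P)}
  isRelLowerSet_faces := fun _ hs =>
    ⟨hs.1, fun _ hts ht => ⟨ht, hs.2.mono (Finset.coe_subset.2 hts)⟩⟩
  singleton_mem v := by
    refine ⟨Finset.singleton_nonempty v, ?_⟩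
    rw [Finset.coe_singleton]
    exact IsChain.singleton

/-- The group of simplicial automorphisms of a simplicial complex `K`: the permutations of the
vertex set that carry simplices to simplices, and whose inverses do so too. -/
def simplicialAut {V : Type*} (K : AbstractSimplicialComplex V) : Subgroup (Equiv.Perm V) where
  carrier := {f | ∀ s : Finset V, s.map f.toEmbedding ∈ K ↔ s ∈ K}
  one_mem' := fun s => by
    have h : s.map (1 : Equiv.Perm V).toEmbedding = s := Finset.map_refl
    rw [h]
  mul_mem' := fun {f g} hf hg s => by
    have h : s.map (f * g).toEmbedding = (s.map g.toEmbedding).map f.toEmbedding := by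
      rw [Finset.map_map]; rfl
    rw [h]
    exact (hf _).trans (hg s)
  inv_mem' := fun {f} hf s => by
    have h : (s.map (f⁻¹).toEmbedding).map f.toEmbedding = s := by
      rw [Finset.map_map]; ext; simp
    have h2 := hf (s.map (f⁻¹).toEmbedding)
    rw [h] at h2
    exact h2.symm

/-! ### Free factors -/

/-- A subgroup `A` of `G` is a free factor if `G = A * B` for some subgroup `B`, that is, if the
natural homomorphism from the free product of `A` and `B` to `G` is an isomorphism. -/
def IsFreeFactor {G : Type*} [Group G] (A : Subgroup G) : Prop :=
  ∃ B : Subgroup G, Function.Bijective (Monoid.Coprod.lift A.subtype B.subtype)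

/-- The non-trivial proper free factors of the free group `F_n`. -/
def ProperFreeFactor (n : ℕ) : Type :=
  {A : Subgroup (FreeGroup (Fin n)) // IsFreeFactor A ∧ A ≠ ⊥ ∧ A ≠ ⊤}

/-- Proper free factors are ordered by inclusion. -/
instance (n : ℕ) : PartialOrder (ProperFreeFactor n) :=
  inferInstanceAs (PartialOrder
    {A : Subgroup (FreeGroup (Fin n)) // IsFreeFactor A ∧ A ≠ ⊥ ∧ A ≠ ⊤})

/-- The complex `AF_n`. -/
def AF (n : ℕ) : AbstractSimplicialComplex (ProperFreeFactor n) :=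
  orderComplex (ProperFreeFactor n)

/-- The set `AF_n(i)` of vertices of rank `i`: the proper free factors that are free groups of
rank `i`. -/
def AFRank (n i : ℕ) : Set (ProperFreeFactor n) :=
  {A | Nonempty (FreeGroupBasis (Fin i) A.1)}

/-! ### Conjugacy classes of free factors -/

/-- Conjugacy of proper free factors in `F_n`. -/
def conjSetoid (n : ℕ) : Setoid (ProperFreeFactor n) where
  r A B := ∃ g : FreeGroup (Fin n), A.1.map (MulAut.conj g).toMonoidHom = B.1
  iseqv :=
    { refl := fun A => ⟨1, by ext x; simp⟩
      symm := fun {A B} ⟨g, hg⟩ => ⟨g⁻¹, by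
        rw [← hg, Subgroup.map_map]; ext x; simp [mul_assoc]⟩
      trans := fun {A B C} ⟨g, hg⟩ ⟨h, hh⟩ => ⟨h * g, by
        rw [← hh, ← hg, Subgroup.map_map]; ext x; simp [mul_assoc]⟩ }

/-- The conjugacy classes of non-trivial proper free factors of `F_n`. -/
def FreeFactorClass (n : ℕ) : Type := Quotient (conjSetoid n)

/-- The conjugacy class `[A]`. -/
def FreeFactorClass.mk {n : ℕ} (A : ProperFreeFactor n) : FreeFactorClass n :=
  Quotient.mk (conjSetoid n) A

/-- Conjugacy classes are ordered by inclusion of representatives. (This order is also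
antisymmetric; the definition of the order complex does not use that.) -/
instance (n : ℕ) : Preorder (FreeFactorClass n) where
  le a b := ∃ A B : ProperFreeFactor n,
    FreeFactorClass.mk A = a ∧ FreeFactorClass.mk B = b ∧ A ≤ B
  le_refl a := by
    obtain ⟨A, rfl⟩ := Quotient.exists_rep a
    exact ⟨A, A, rfl, rfl, le_refl A⟩
  le_trans := by
    rintro a b c ⟨A, B, rfl, rfl, hAB⟩ ⟨B', C, hB, rfl, hBC⟩
    obtain ⟨g, hg⟩ : (conjSetoid n).r B B' := Quotient.exact hB.symm
    let e := MulAut.conj g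
    have hfac : IsFreeFactor (A.1.map e.toMonoidHom) := by
      obtain ⟨D, hD⟩ := A.2.1
      refine ⟨D.map e.toMonoidHom, ?_⟩
      let p := MulEquiv.coprodCongr (e.subgroupMap A.1) (e.subgroupMap D)
      have key : (Monoid.Coprod.lift (A.1.map e.toMonoidHom).subtype
          (D.map e.toMonoidHom).subtype).comp p.toMonoidHom
          = e.toMonoidHom.comp (Monoid.Coprod.lift A.1.subtype D.subtype) := by
        ext x <;> rfl
      have hb : Function.Bijective ((Monoid.Coprod.lift (A.1.map e.toMonoidHom).subtype
          (D.map e.toMonoidHom).subtype) ∘ p) := by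
        have h2 : ((Monoid.Coprod.lift (A.1.map e.toMonoidHom).subtype
            (D.map e.toMonoidHom).subtype) ∘ p)
            = e ∘ (Monoid.Coprod.lift A.1.subtype D.subtype) :=
          congrArg DFunLike.coe key
        rw [h2]
        exact e.bijective.comp hD
      exact (Function.Bijective.of_comp_iff _ p.bijective).1 hb
    have hbot : A.1.map e.toMonoidHom ≠ ⊥ := fun h =>
      A.2.2.1 ((Subgroup.map_eq_bot_iff_of_injective A.1 e.injective).1 h)
    have hle : A.1.map e.toMonoidHom ≤ C.1 :=
      (Subgroup.map_mono (show A.1 ≤ B.1 from hAB)).trans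
        (hg.le.trans (show B'.1 ≤ C.1 from hBC))
    have htop : A.1.map e.toMonoidHom ≠ ⊤ := fun h => C.2.2.2 (top_le_iff.1 (h.ge.trans hle))
    exact ⟨⟨A.1.map e.toMonoidHom, hfac, hbot, htop⟩, C,
      Quotient.sound ((conjSetoid n).symm ⟨g, rfl⟩), rfl, hle⟩

/-- The complex `OF_n`. -/
def OF (n : ℕ) : AbstractSimplicialComplex (FreeFactorClass n) :=
  orderComplex (FreeFactorClass n)

/-- The set of vertices of `OF_n` of rank `i`: the conjugacy classes of the proper free factors
of rank `i`. -/
def OFRank (n i : ℕ) : Set (FreeFactorClass n) :=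
  FreeFactorClass.mk '' AFRank n i

/-! A simplicial automorphism preserves comparability; the point is that it cannot reverse the
order. A basis of F_n gives a frame: the free factors spanned by its parts, ordered like the
non-empty proper subsets of an n-element set. For n ≥ 3 an automorphism preserves all strict
inclusions of a frame or reverses them all, because reversal spreads from one pair to any other by
replacing one member at a time by an incomparable one (`reversed_frame`). The only strictly
increasing function from these subsets to [1, n - 1] is the cardinality, so ranks are kept in the
first case, and rank i becomes n - i in the second.

Reversal is excluded by an asymmetry between rank 1 and corank 1. If L has corank 1 and p is spanned
by the missing basis element, every q ≤ L of rank 1 lies with p in a factor of rank 2 (`joins`). The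
dual statement fails: for every p of rank 1 not below L, some M ≥ p of corank 1 shares no factor of
corank 2 with L (`transverse`).

Two algebraic facts make free factors, and their conjugacy classes, into a `FramedOrder`. Schreier's
method gives a subgroup a basis containing the ambient basis elements that lie in it, so nested free
factors have a common basis and joins exist. For `transverse`, M is obtained by a transvection with
a high power of a basis element y having no power conjugate into L: reduced words of the finitely
generated group L contain no high power of y, so M meets L in little. For n ≤ 2 the only rank is 1.
-/

/-! ### Comparability automorphisms of framed orders -/

/-- The non-empty proper subsets of `Fin n`. -/
abbrev ProperSubset (n : ℕ) : Type := {S : Finset (Fin n) // S.Nonempty ∧ S ≠ Finset.univ}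

/-- An ordered set with a rank function which, like the set of free factors of a free group of
rank `n`, is covered by frames (the free factors spanned by the parts of a basis), any two comparable
elements lying in a common frame. The last two axioms distinguish the elements of rank `1` from
those of rank `n - 1`. -/
structure FramedOrder (P : Type*) [Preorder P] (n : ℕ) where
  /-- The frames. -/
  Frame : Type
  /-- The rank function. -/
  rk : P → ℕ
  /-- The element of a frame given by a set of indices. -/
  std : Frame → ProperSubset n → P
  rk_std : ∀ b S, rk (std b S) = S.1.card
  std_le_iff : ∀ b S T, std b S ≤ std b T ↔ S.1 ⊆ T.1
  adapted : ∀ a c, a ≤ c → ∃ b S T, std b S = a ∧ std b T = c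
  joins : ∀ L, rk L = n - 1 → ∃ p, rk p = 1 ∧ ¬ p ≤ L ∧
    ∀ q, rk q = 1 → q ≤ L → ∃ C, rk C = 2 ∧ p ≤ C ∧ q ≤ C
  transverse : ∀ L p, rk L = n - 1 → rk p = 1 → ¬ p ≤ L →
    ∃ M, rk M = n - 1 ∧ p ≤ M ∧ ∀ K, rk K = n - 2 → K ≤ M → ¬ K ≤ L

namespace FramedOrder

variable {P : Type*} [Preorder P] {n : ℕ} (D : FramedOrder P n)

theorem exists_std (a : P) : ∃ b S, D.std b S = a := by
  obtain ⟨b, S, _, h, _⟩ := D.adapted a a le_rfl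
  exact ⟨b, S, h⟩

/-- In a common frame this is a fact about finite sets. With `rk_le` it supplies the antisymmetry
that a preorder lacks. -/
theorem eq_of_rk_le {a c : P} (h : a ≤ c) (hr : D.rk c ≤ D.rk a) : a = c := by
  obtain ⟨b, S, T, rfl, rfl⟩ := D.adapted a c h
  rw [D.std_le_iff] at h
  rw [D.rk_std, D.rk_std] at hr
  rw [Subtype.ext (Finset.eq_of_subset_of_card_le h hr)]

theorem rk_le {a c : P} (h : a ≤ c) : D.rk a ≤ D.rk c := by
  obtain ⟨b, S, T, rfl, rfl⟩ := D.adapted a c h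
  rw [D.std_le_iff] at h
  rw [D.rk_std, D.rk_std]
  exact Finset.card_le_card h

theorem rk_lt {a c : P} (h : a ≤ c) (hne : a ≠ c) : D.rk a < D.rk c :=
  lt_of_not_ge fun h' => hne (D.eq_of_rk_le h h')

theorem one_le_rk (a : P) : 1 ≤ D.rk a := by
  obtain ⟨b, S, rfl⟩ := D.exists_std a
  rw [D.rk_std]
  exact S.2.1.card_pos

theorem rk_lt_top (a : P) : D.rk a < n := by
  obtain ⟨b, S, rfl⟩ := D.exists_std a
  rw [D.rk_std]
  simpa using (Finset.card_lt_iff_ne_univ S.1).2 S.2.2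

/-- The permutations that preserve comparability. -/
def Comparability (φ : Equiv.Perm P) : Prop :=
  ∀ a c, (φ a ≤ φ c ∨ φ c ≤ φ a) ↔ (a ≤ c ∨ c ≤ a)

theorem Comparability.symm {φ : Equiv.Perm P} (h : Comparability φ) : Comparability φ.symm := by
  intro a c
  rw [← h]
  simp

theorem forward_of_not_reversed {φ : Equiv.Perm P} (hφ : Comparability φ) {a c : P} (h : a ≤ c) (hn : ¬ φ c ≤ φ a) : φ a ≤ φ c :=
  ((hφ a c).2 (Or.inl h)).resolve_right hn

/-- Otherwise `φ c ≤ φ a ≤ φ c'`, and `c` and `c'` would be comparable. Reversal thus passes from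
one upper member to any incomparable one; `reversed_lower` is the dual. -/
theorem reversed_upper {φ : Equiv.Perm P} (hφ : Comparability φ) {a c c' : P} (h' : a ≤ c') (i : ¬ c ≤ c') (j : ¬ c' ≤ c)
    (hr : φ c ≤ φ a) : φ c' ≤ φ a := by
  by_contra hn
  rcases (hφ c c').1 (Or.inl (hr.trans (forward_of_not_reversed hφ h' hn))) with h | h
  · exact i h
  · exact j h

theorem reversed_lower {φ : Equiv.Perm P} (hφ : Comparability φ) {a a' c : P} (h' : a' ≤ c) (i : ¬ a ≤ a') (j : ¬ a' ≤ a)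
    (hr : φ c ≤ φ a) : φ c ≤ φ a' := by
  by_contra hn
  rcases (hφ a a').1 (Or.inr ((forward_of_not_reversed hφ h' hn).trans hr)) with h | h
  · exact i h
  · exact j h

/-- A singleton as a proper subset. -/
def single (hn : 3 ≤ n) (i : Fin n) : ProperSubset n :=
  ⟨{i}, Finset.singleton_nonempty i, fun h => by
    have := congrArg Finset.card h
    simp at this
    omega⟩

/-- The complement of a singleton as a proper subset. -/
def cosingle (hn : 3 ≤ n) (i : Fin n) : ProperSubset n :=
  ⟨{i}ᶜ, by
    rw [← Finset.card_pos, Finset.card_compl]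
    simp
    omega, fun h => by
    have := congrArg Finset.card h
    rw [Finset.card_compl] at this
    simp at this
    omega⟩

/-- Distinct singletons are incomparable, and so are distinct complements, so either member of the
pair can be changed while reversal is kept, as long as the pair stays nested. -/
theorem reversed_single_cosingle {φ : Equiv.Perm P} (hφ : Comparability φ) (hn : 3 ≤ n)
    (b : D.Frame) {i j k l : Fin n} (hlk : l ≠ k) (hij : i ≠ j)
    (hr : φ (D.std b (cosingle hn k)) ≤ φ (D.std b (single hn l))) :
    φ (D.std b (cosingle hn j)) ≤ φ (D.std b (single hn i)) := by
  have low : ∀ {l k m : Fin n}, m ≠ k →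
      φ (D.std b (cosingle hn k)) ≤ φ (D.std b (single hn l)) →
      φ (D.std b (cosingle hn k)) ≤ φ (D.std b (single hn m)) := by
    intro l k m hm h
    rcases eq_or_ne l m with rfl | hlm
    · exact h
    refine reversed_lower hφ ?_ ?_ ?_ h <;>
      simp [D.std_le_iff, single, cosingle, hm.symm, hlm, hlm.symm]
  have upp : ∀ {l k m : Fin n}, l ≠ m → l ≠ k →
      φ (D.std b (cosingle hn k)) ≤ φ (D.std b (single hn l)) →
      φ (D.std b (cosingle hn m)) ≤ φ (D.std b (single hn l)) := by
    intro l k m hm hlk h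
    rcases eq_or_ne k m with rfl | hkm
    · exact h
    refine reversed_upper hφ ?_ ?_ ?_ h <;>
      simp [D.std_le_iff, single, cosingle, hm.symm, hkm, hkm.symm]
  rcases eq_or_ne i k with rfl | hik
  -- As `{i}` is not below `{k}ᶜ` for `i = k`, a third index is needed; it exists because `n ≥ 3`.
  -- The route is (l, k), (m, k), (m, j), (i, j).
  · obtain ⟨m, hm⟩ : ∃ m, m ∉ ({i, j} : Finset (Fin n)) := by
      by_contra! h
      have h1 := Finset.card_le_card (fun x _ => h x : Finset.univ ⊆ ({i, j} : Finset (Fin n)))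
      have h2 := Finset.card_le_two (a := i) (b := j)
      simp at h1
      omega
    simp only [Finset.mem_insert, Finset.mem_singleton, not_or] at hm
    exact low hij (upp hm.2 hm.1 (low hm.1 hr))
  · exact upp hij hik (low hik hr)

/-- For `k ∈ T \ S` and `l ∉ T`, the set `{k}ᶜ` is incomparable with `T`, and `{l}` with `S`. Hence
reversal passes from `(S, T)` to `(S, {k}ᶜ)` and on to `({l}, {k}ᶜ)`, and back in the same way for
the other pair. -/
theorem reversed_frame {φ : Equiv.Perm P} (hφ : Comparability φ) (hn : 3 ≤ n)
    (b : D.Frame) {S T S' T' : ProperSubset n} (hST : S.1 ⊂ T.1) (hST' : S'.1 ⊂ T'.1)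
    (hr : φ (D.std b T) ≤ φ (D.std b S)) : φ (D.std b T') ≤ φ (D.std b S') := by
  have pick : ∀ {S T : ProperSubset n}, S.1 ⊂ T.1 → ∃ k l, k ∈ T.1 ∧ k ∉ S.1 ∧ l ∉ T.1 ∧
      S.1 ⊆ {k}ᶜ ∧ ¬ T.1 ⊆ {k}ᶜ ∧ ¬ {k}ᶜ ⊆ T.1 ∧ ¬ S.1 ⊆ {l} ∧ ¬ {l} ⊆ S.1 ∧ l ≠ k := by
    intro S T h
    obtain ⟨k, hkT, hkS⟩ := Finset.exists_of_ssubset h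
    obtain ⟨l, hl⟩ : ∃ l, l ∉ T.1 := by
      by_contra! h'
      exact T.2.2 (Finset.eq_univ_iff_forall.2 h')
    have hlk : l ≠ k := fun e => hl (e ▸ hkT)
    refine ⟨k, l, hkT, hkS, hl, ?_, ?_, ?_, ?_, ?_, hlk⟩
    · intro x hx
      simp only [Finset.mem_compl, Finset.mem_singleton]
      rintro rfl
      exact hkS hx
    · intro h'
      simpa using h' hkT
    · intro h'
      exact hl (h' (by simpa using hlk))
    · intro h'
      obtain ⟨x, hx⟩ := S.2.1
      have := Finset.mem_singleton.1 (h' hx)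
      exact hl (this ▸ h.1 hx)
    · intro h'
      exact hl (h.1 (h' (Finset.mem_singleton_self l)))
  obtain ⟨k, l, _, _, hl, h1, h2, h3, h4, h5, hlk⟩ := pick hST
  obtain ⟨k', l', _, _, hl', h1', h2', h3', h4', h5', hlk'⟩ := pick hST'
  have e1 : φ (D.std b (cosingle hn k)) ≤ φ (D.std b S) :=
    reversed_upper hφ ((D.std_le_iff _ _ _).2 h1) (mt (D.std_le_iff _ _ _).1 h2)
      (mt (D.std_le_iff _ _ _).1 h3) hr
  have e2 : φ (D.std b (cosingle hn k)) ≤ φ (D.std b (single hn l)) :=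
    reversed_lower hφ ((D.std_le_iff _ _ _).2 (by simpa [single, cosingle] using hlk.symm))
      (mt (D.std_le_iff _ _ _).1 h4) (mt (D.std_le_iff _ _ _).1 h5) e1
  have e3 := D.reversed_single_cosingle hφ hn b hlk hlk' e2
  have e4 : φ (D.std b (cosingle hn k')) ≤ φ (D.std b S') :=
    reversed_lower hφ ((D.std_le_iff _ _ _).2 h1')
      (mt (D.std_le_iff _ _ _).1 h5') (mt (D.std_le_iff _ _ _).1 h4') e3
  exact reversed_upper hφ ((D.std_le_iff _ _ _).2 hST'.1) (mt (D.std_le_iff _ _ _).1 h3')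
      (mt (D.std_le_iff _ _ _).1 h2') e4

/-- A map which is strictly increasing on the proper subsets and takes values in `[1, n - 1]` is
the cardinality. -/
theorem eq_card_of_strictMono {f : ProperSubset n → ℕ} (h1 : ∀ S, 1 ≤ f S) (h2 : ∀ S, f S < n)
    (hf : ∀ S T : ProperSubset n, S.1 ⊂ T.1 → f S < f T) (S : ProperSubset n) :
    f S = S.1.card := by
  -- Removing elements one at a time down to a singleton bounds `f S` below; adding them up to a
  -- complement of a singleton bounds it above.
  have lower : ∀ m, ∀ S : ProperSubset n, S.1.card = m → m ≤ f S := by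
    intro m
    induction m with
    | zero => intro S _; exact Nat.zero_le _
    | succ m ih =>
      intro S hS
      rcases Nat.eq_zero_or_pos m with rfl | hm
      · exact h1 S
      obtain ⟨x, hx⟩ := S.2.1
      have hc : (S.1.erase x).card = m := by rw [Finset.card_erase_of_mem hx, hS]; rfl
      have hs : S.1.erase x ⊂ S.1 := Finset.erase_ssubset hx
      let S' : ProperSubset n := ⟨S.1.erase x, Finset.card_pos.1 (by omega), fun h =>
        S.2.2 (Finset.eq_univ_iff_forall.2 fun y => hs.1 (by rw [h]; exact Finset.mem_univ y))⟩
      have := hf S' S hs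
      have := ih S' hc
      omega
  have upper : ∀ m, ∀ S : ProperSubset n, n - S.1.card = m → f S + m ≤ n := by
    intro m
    induction m with
    | zero => intro S _; exact (h2 S).le
    | succ m ih =>
      intro S hS
      rcases Nat.eq_zero_or_pos m with rfl | hm
      · exact h2 S
      obtain ⟨x, hx⟩ : ∃ x, x ∉ S.1 := by
        by_contra! h'
        exact S.2.2 (Finset.eq_univ_iff_forall.2 h')
      have hc : (insert x S.1).card = S.1.card + 1 := Finset.card_insert_of_notMem hx
      have hs : S.1 ⊂ insert x S.1 := Finset.ssubset_insert hx
      let S' : ProperSubset n := ⟨insert x S.1, Finset.insert_nonempty _ _, fun h => by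
        rw [h] at hc
        simp at hc
        omega⟩
      have := hf S S' hs
      have := ih S' (by simp only [S', hc]; omega)
      omega
  have hS : S.1.card < n := by simpa using (Finset.card_lt_iff_ne_univ S.1).2 S.2.2
  have := lower _ S rfl
  have := upper _ S rfl
  omega

/-- The function `n - rk ∘ φ` is strictly increasing on a frame that is reversed, so it is the
cardinality. -/
theorem rk_reversed {φ : Equiv.Perm P} (hφ : Comparability φ) (hn : 3 ≤ n)
    (b : D.Frame) {S T : ProperSubset n} (hST : S.1 ⊂ T.1)
    (hr : φ (D.std b T) ≤ φ (D.std b S)) (U : ProperSubset n) :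
    D.rk (φ (D.std b U)) + D.rk (D.std b U) = n := by
  have key := eq_card_of_strictMono (n := n) (f := fun S => n - D.rk (φ (D.std b S)))
    (fun S => by have := D.rk_lt_top (φ (D.std b S)); omega)
    (fun S => by have := D.one_le_rk (φ (D.std b S)); omega)
    (fun S' T' h => by
      have h' := D.reversed_frame hφ hn b hST h hr
      have hne : φ (D.std b T') ≠ φ (D.std b S') := fun e => by
        have := (D.std_le_iff b T' S').1 (φ.injective e).le
        exact h.2 this
      have := D.rk_lt h' hne
      have := D.rk_lt_top (φ (D.std b S'))
      omega) U
  rw [D.rk_std]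
  have := D.rk_lt_top (φ (D.std b U))
  omega

theorem rk_forward {φ : Equiv.Perm P} (hφ : Comparability φ)
    (b : D.Frame) (hr : ∀ S T : ProperSubset n, S.1 ⊂ T.1 → ¬ φ (D.std b T) ≤ φ (D.std b S))
    (U : ProperSubset n) : D.rk (φ (D.std b U)) = D.rk (D.std b U) := by
  rw [D.rk_std]
  exact eq_card_of_strictMono (n := n) (f := fun S => D.rk (φ (D.std b S)))
    (fun S => D.one_le_rk _) (fun S => D.rk_lt_top _)
    (fun S' T' h => D.rk_lt
      (forward_of_not_reversed hφ ((D.std_le_iff _ _ _).2 h.1) (hr S' T' h))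
      (fun e => h.2 ((D.std_le_iff b T' S').1 (φ.injective e).ge))) U

theorem rk_of_reversed {φ : Equiv.Perm P} (hφ : Comparability φ) (hn : 3 ≤ n) {a c : P}
    (h : a ≤ c) (hne : a ≠ c) (hr : φ c ≤ φ a) :
    D.rk (φ a) + D.rk a = n ∧ D.rk (φ c) + D.rk c = n := by
  obtain ⟨b, S, T, rfl, rfl⟩ := D.adapted a c h
  have hST : S.1 ⊂ T.1 := Finset.ssubset_iff_subset_ne.2 ⟨(D.std_le_iff _ _ _).1 h,
    fun e => hne (by rw [Subtype.ext e])⟩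
  exact ⟨D.rk_reversed hφ hn b hST hr S, D.rk_reversed hφ hn b hST hr T⟩

theorem not_le_of_rk_eq {a c : P} (h : D.rk a = D.rk c) (hne : a ≠ c) : ¬ a ≤ c :=
  fun h' => hne (D.eq_of_rk_le h' h.ge)

/-- If `p` has rank one and is not below `L` of corank one, and `q ≤ L` of rank one is joined to `p`
by `C` of rank two, then a comparability automorphism reversing `q ≤ L` reverses `q ≤ C` and
`p ≤ C`. -/
theorem reversed_join {φ : Equiv.Perm P} (hφ : Comparability φ) (hn : 3 ≤ n) {L p q C : P}
    (hL : D.rk L = n - 1) (hp : D.rk p = 1) (hq : D.rk q = 1) (hC : D.rk C = 2) (hpL : ¬ p ≤ L)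
    (hqL : q ≤ L) (hpC : p ≤ C) (hqC : q ≤ C) (hr : φ L ≤ φ q) : φ C ≤ φ q ∧ φ C ≤ φ p := by
  have hCL : ¬ C ≤ L := fun h => hpL (hpC.trans h)
  have hLC : ¬ L ≤ C := fun h => by
    have := D.eq_of_rk_le h (by omega)
    exact hCL this.ge
  have hpq : p ≠ q := fun e => hpL (e ▸ hqL)
  have h1 := reversed_upper hφ hqC hLC hCL hr
  exact ⟨h1, reversed_lower hφ hpC (D.not_le_of_rk_eq (by omega) hpq.symm)
    (D.not_le_of_rk_eq (by omega) hpq) h1⟩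

/-- A reversal turns the joins of `p` with the rank 1 elements below `L` into elements of rank `n -
2` common to `φ p` and elements of corank 1 above `φ L`. This contradicts `transverse` for `φ p` and
`φ L`, whose ranks are `n - 1` and 1. -/
theorem not_reversed {φ : Equiv.Perm P} (hφ : Comparability φ) (hn : 3 ≤ n)
    (b : D.Frame) {S T : ProperSubset n} (hST : S.1 ⊂ T.1) :
    ¬ φ (D.std b T) ≤ φ (D.std b S) := by
  intro hr
  let i : Fin n := ⟨0, by omega⟩
  let j : Fin n := ⟨1, by omega⟩
  have hij : i ≠ j := by simp [i, j]
  set L := D.std b (cosingle hn j) with hLdef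
  set q := D.std b (single hn i) with hqdef
  have hsub : (single hn i).1 ⊂ (cosingle hn j).1 := by
    rw [Finset.ssubset_iff_subset_ne]
    refine ⟨by simpa [single, cosingle] using hij.symm, fun e => ?_⟩
    have := congrArg Finset.card e
    simp only [single, cosingle, Finset.card_compl, Finset.card_singleton, Fintype.card_fin] at this
    omega
  have hL : D.rk L = n - 1 := by simp [hLdef, D.rk_std, cosingle, Finset.card_compl]
  have hq : D.rk q = 1 := by simp [hqdef, D.rk_std, single]
  have hqL : q ≤ L := (D.std_le_iff _ _ _).2 hsub.1
  have hqL' : φ L ≤ φ q := D.reversed_frame hφ hn b hST hsub hr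
  obtain ⟨p, hp, hpL, hjoin⟩ := D.joins L hL
  obtain ⟨C, hC, hpC, hqC⟩ := hjoin q hq hqL
  obtain ⟨-, hpC'⟩ := D.reversed_join hφ hn hL hp hq hC hpL hqL hpC hqC hqL'
  have rp : D.rk (φ p) = n - 1 := by
    have := (D.rk_of_reversed hφ hn hpC (fun e => by rw [e] at hp; omega) hpC').1
    omega
  have hLq : q ≠ L := fun e => by rw [e] at hq; omega
  obtain ⟨rq, rL⟩ := D.rk_of_reversed hφ hn hqL hLq hqL'
  have hLp : ¬ L ≤ p := fun h => by have := D.rk_le h; omega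
  obtain ⟨M, hM, hLM, hMK⟩ := D.transverse (φ p) (φ L) rp (by omega) (fun h =>
    ((hφ L p).1 (Or.inl h)).elim hLp hpL)
  obtain ⟨r, rfl⟩ := φ.surjective M
  -- If `L ≤ r` instead, then `q ≤ r`, so `φ q` and `φ r` would be comparable, distinct and both of
  -- rank `n - 1`.
  have hrL : r ≤ L := by
    by_contra hn'
    have hLr : L ≤ r := ((hφ L r).1 (Or.inl hLM)).resolve_right hn'
    have hqr : φ q ≠ φ r := fun e => hn' (φ.injective e ▸ hqL)
    rcases (hφ q r).2 (Or.inl (hqL.trans hLr)) with h | h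
    · exact D.not_le_of_rk_eq (by omega) hqr h
    · exact D.not_le_of_rk_eq (by omega) hqr.symm h
  have hrL' : r ≠ L := fun e => by rw [e] at hM; omega
  have rr := (D.rk_of_reversed hφ hn hrL hrL' hLM).1
  have hr1 : D.rk r = 1 := by omega
  obtain ⟨C', hC', hpC', hrC'⟩ := hjoin r hr1 hrL
  obtain ⟨h1, h2⟩ := D.reversed_join hφ hn hL hp hr1 hC' hpL hrL hpC' hrC' hLM
  have := (D.rk_of_reversed hφ hn hpC' (fun e => by rw [e] at hp; omega) h2).2
  exact hMK (φ C') (by omega) h1 h2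

theorem rk_eq_of_comparability {φ : Equiv.Perm P} (hφ : Comparability φ) (hn : 3 ≤ n) (a : P) :
    D.rk (φ a) = D.rk a := by
  obtain ⟨b, S, rfl⟩ := D.exists_std a
  exact D.rk_forward hφ b (fun S T h => D.not_reversed hφ hn b h) S

end FramedOrder

/-! ### Subgroups spanned by parts of a basis -/

namespace FreeGroupBasis

section Span

variable {ι κ G : Type*} [Group G]

@[simp]
theorem lift_apply_coe {H : Type*} [Group H] (b : FreeGroupBasis ι G) (f : ι → H) (i : ι) :
    b.lift f (b i) = f i :=
  congrFun (b.lift.symm_apply_apply f) i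

theorem closure_range (b : FreeGroupBasis ι G) : Subgroup.closure (Set.range b) = ⊤ := by
  have h : Set.range b = b.repr.symm.toMonoidHom '' Set.range FreeGroup.of := by
    rw [← Set.range_comp]
    rfl
  rw [h, ← MonoidHom.map_closure, FreeGroup.closure_range_of]
  exact Subgroup.map_top_of_surjective _ b.repr.symm.surjective

/-- A generating family which some homomorphism maps to the standard basis is a basis. -/
theorem exists_of_leftInverse (v : ι → G) (f : G →* FreeGroup ι)
    (hf : ∀ i, f (v i) = FreeGroup.of i) (hv : Subgroup.closure (Set.range v) = ⊤) :
    ∃ b : FreeGroupBasis ι G, ∀ i, b i = v i := by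
  refine ⟨ofRepr (MonoidHom.toMulEquiv f (FreeGroup.lift v) ?_ ?_), fun i => ?_⟩
  · refine MonoidHom.eq_of_eqOn_dense hv ?_
    rintro _ ⟨i, rfl⟩
    simp [hf]
  · ext i
    simp [hf]
  · change FreeGroup.lift v (FreeGroup.of i) = v i
    simp

/-- The subgroup generated by part of a basis. -/
def span (b : FreeGroupBasis ι G) (S : Set ι) : Subgroup G :=
  Subgroup.closure (b '' S)

theorem mem_span (b : FreeGroupBasis ι G) {S : Set ι} {i : ι} (hi : i ∈ S) : b i ∈ b.span S :=
  Subgroup.subset_closure (Set.mem_image_of_mem b hi)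

theorem span_le (b : FreeGroupBasis ι G) {S : Set ι} {H : Subgroup G} :
    b.span S ≤ H ↔ ∀ i ∈ S, b i ∈ H := by
  rw [span, Subgroup.closure_le, Set.image_subset_iff]
  rfl

theorem span_mono (b : FreeGroupBasis ι G) {S T : Set ι} (h : S ⊆ T) : b.span S ≤ b.span T :=
  b.span_le.2 fun _ hi => b.mem_span (h hi)

theorem span_univ (b : FreeGroupBasis ι G) : b.span Set.univ = ⊤ := by
  rw [span, Set.image_univ, b.closure_range]

theorem span_map {H : Type*} [Group H] (b : FreeGroupBasis ι G) (e : G ≃* H) (S : Set ι) :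
    (b.map e).span S = (b.span S).map e.toMonoidHom := by
  rw [span, span, MonoidHom.map_closure, Set.image_image]
  rfl

/-- The homomorphism killing the basis elements outside `S` maps the generators of the span to the
standard basis. -/
theorem exists_basis_span (b : FreeGroupBasis ι G) (S : Set ι) :
    ∃ c : FreeGroupBasis S (b.span S), ∀ i, (c i : G) = b i := by
  classical
  obtain ⟨c, hc⟩ := exists_of_leftInverse (fun i : S => (⟨b i, b.mem_span i.2⟩ : b.span S))
    ((b.lift fun i => if h : i ∈ S then FreeGroup.of (⟨i, h⟩ : S) else 1).comp (b.span S).subtype)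
    (fun i => by simp) (by
      refine (Subgroup.map_injective (b.span S).subtype_injective) ?_
      rw [MonoidHom.map_closure, ← Set.range_comp, ← MonoidHom.range_eq_map, Subgroup.range_subtype]
      change _ = Subgroup.closure (b '' S)
      congr 1
      ext x
      simp)
  exact ⟨c, fun i => by rw [hc]⟩

theorem bijective_coprod_span (b : FreeGroupBasis ι G) (S : Set ι) :
    Function.Bijective (Monoid.Coprod.lift (b.span S).subtype (b.span Sᶜ).subtype) := by
  classical
  constructor
  · let r : G →* Monoid.Coprod (b.span S) (b.span Sᶜ) := b.lift fun i =>
      if h : i ∈ S then Monoid.Coprod.inl ⟨b i, b.mem_span h⟩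
      else Monoid.Coprod.inr ⟨b i, b.mem_span h⟩
    have h : r.comp (Monoid.Coprod.lift (b.span S).subtype (b.span Sᶜ).subtype)
        = MonoidHom.id _ := by
      obtain ⟨c, hc⟩ := b.exists_basis_span S
      obtain ⟨c', hc'⟩ := b.exists_basis_span Sᶜ
      refine Monoid.Coprod.hom_ext (c.ext_hom _ _ fun i => ?_) (c'.ext_hom _ _ fun i => ?_)
      · have : c i = ⟨b i, b.mem_span i.2⟩ := Subtype.ext (hc i)
        simp [this, r]
      · have : c' i = ⟨b i, b.mem_span i.2⟩ := Subtype.ext (hc' i)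
        have hi : (i : ι) ∉ S := i.2
        simp [this, r, hi]
    exact Function.LeftInverse.injective (g := r) (DFunLike.congr_fun h)
  · rw [← MonoidHom.range_eq_top, ← top_le_iff, ← b.span_univ, b.span_le]
    intro i _
    by_cases h : i ∈ S
    · exact ⟨Monoid.Coprod.inl ⟨b i, b.mem_span h⟩, by simp⟩
    · exact ⟨Monoid.Coprod.inr ⟨b i, b.mem_span h⟩, by simp⟩

theorem exists_basis_of_coprod {A B : Subgroup G}
    (h : Function.Bijective (Monoid.Coprod.lift A.subtype B.subtype))
    (c : FreeGroupBasis ι A) (d : FreeGroupBasis κ B) :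
    ∃ b : FreeGroupBasis (ι ⊕ κ) G, (∀ i, b (Sum.inl i) = c i) ∧ ∀ j, b (Sum.inr j) = d j := by
  let e := MulEquiv.ofBijective _ h
  have hl : ∀ a : A, e.symm a = Monoid.Coprod.inl a := fun a => by
    rw [MulEquiv.symm_apply_eq]; simp [e]
  have hr : ∀ a : B, e.symm a = Monoid.Coprod.inr a := fun a => by
    rw [MulEquiv.symm_apply_eq]; simp [e]
  obtain ⟨b, hb⟩ := exists_of_leftInverse
    (Sum.elim (fun i => (c i : G)) (fun j => (d j : G)))
    ((Monoid.Coprod.lift ((FreeGroup.map Sum.inl).comp c.repr.toMonoidHom)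
      ((FreeGroup.map Sum.inr).comp d.repr.toMonoidHom)).comp e.symm.toMonoidHom)
    (by rintro (i | j) <;> simp [hl, hr]) (by
      set K := Subgroup.closure (Set.range (Sum.elim (fun i => (c i : G)) (fun j => (d j : G))))
      have hA : A ≤ K := by
        have : (⊤ : Subgroup A) ≤ K.comap A.subtype := by
          rw [← c.closure_range, Subgroup.closure_le]
          rintro _ ⟨i, rfl⟩
          exact Subgroup.subset_closure ⟨Sum.inl i, rfl⟩
        exact fun x hx => this (Subgroup.mem_top ⟨x, hx⟩)
      have hB : B ≤ K := by
        have : (⊤ : Subgroup B) ≤ K.comap B.subtype := by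
          rw [← d.closure_range, Subgroup.closure_le]
          rintro _ ⟨i, rfl⟩
          exact Subgroup.subset_closure ⟨Sum.inr i, rfl⟩
        exact fun x hx => this (Subgroup.mem_top ⟨x, hx⟩)
      rw [← top_le_iff, ← MonoidHom.range_eq_top.2 h.2, Monoid.Coprod.range_lift]
      simpa using ⟨hA, hB⟩)
  exact ⟨b, fun i => hb _, fun j => hb _⟩

theorem nonempty_equiv (b : FreeGroupBasis ι G) (c : FreeGroupBasis κ G) : Nonempty (ι ≃ κ) :=
  ⟨Equiv.ofFreeGroupEquiv (b.repr.symm.trans c.repr)⟩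

theorem span_le_ker {H : Type*} [Group H] (b : FreeGroupBasis ι G) {S : Set ι} {f : G →* H}
    (h : ∀ i ∈ S, f (b i) = 1) : b.span S ≤ f.ker :=
  b.span_le.2 fun i hi => f.mem_ker.2 (h i hi)

/-- The exponent sum of `b i` is invariant under conjugation, equals 1 on `b i` and vanishes on
`b.span T` when `i ∉ T`. -/
theorem subset_of_conj_span_le (b : FreeGroupBasis ι G) {S T : Set ι} {g : G}
    (h : (b.span S).map (MulAut.conj g).toMonoidHom ≤ b.span T) : S ⊆ T := by
  classical
  intro i hi
  by_contra hiT
  let f : G →* Multiplicative ℤ := b.lift fun j => if j = i then Multiplicative.ofAdd 1 else 1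
  have h1 : b.span T ≤ f.ker := b.span_le_ker fun j hj => by
    have : j ≠ i := fun e => hiT (e ▸ hj)
    simp [f, this]
  have h2 := h1 (h ⟨b i, b.mem_span hi, rfl⟩)
  rw [f.mem_ker] at h2
  simp [f] at h2

theorem span_le_span_iff (b : FreeGroupBasis ι G) {S T : Set ι} :
    b.span S ≤ b.span T ↔ S ⊆ T := by
  refine ⟨fun h => b.subset_of_conj_span_le (g := 1) (le_trans ?_ h), b.span_mono⟩
  rintro _ ⟨x, hx, rfl⟩
  simpa using hx

/-- The conditions at `s` keep `b s` fixed, so the opposite exponents give the inverse. Both sides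
are needed: right multiplications adjust a homomorphism to the integers, left ones build the
transverse factor. -/
theorem exists_transvection (b : FreeGroupBasis ι G) (s : ι) (e f : ι → ℤ) (he : e s = 0)
    (hf : f s = 0) :
    ∃ c : FreeGroupBasis ι G, ∀ i, c i = b s ^ e i * b i * b s ^ f i := by
  refine exists_of_leftInverse _
    (b.lift fun i => FreeGroup.of s ^ (-e i) * FreeGroup.of i * FreeGroup.of s ^ (-f i))
    (fun i => ?_) ?_
  · simp [he, hf, mul_assoc]
  · rw [← top_le_iff, ← b.span_univ, b.span_le]
    intro i _
    have hs : b s ∈ Subgroup.closure (Set.range fun i => b s ^ e i * b i * b s ^ f i) :=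
      Subgroup.subset_closure ⟨s, by simp [he, hf]⟩
    have hi : b s ^ e i * b i * b s ^ f i
        ∈ Subgroup.closure (Set.range fun i => b s ^ e i * b i * b s ^ f i) :=
      Subgroup.subset_closure ⟨i, rfl⟩
    have := Subgroup.mul_mem _ (Subgroup.mul_mem _ (Subgroup.zpow_mem _ hs (-e i)) hi)
      (Subgroup.zpow_mem _ hs (-f i))
    simpa [mul_assoc] using this

end Span

end FreeGroupBasis

/-! ### Schreier bases of subgroups -/

namespace FreeGroupBasis

theorem ofUniqueLift_apply {G X : Type} [Group G] (v : X → G)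
    (h : ∀ {H : Type} [Group H] (f : X → H), ∃! F : G →* H, ∀ a, F (v a) = f a) (i : X) :
    ofUniqueLift X v h i = v i := by
  change FreeGroup.lift v (FreeGroup.of i) = v i
  simp

section Schreier

variable {ι : Type} {V : Type} [MulAction (FreeGroup ι) V]

/-- `t` is a Schreier transversal for a transitive action of a free group with base point `v₀`: every
`t v` but `t v₀ = 1` is obtained from another one by multiplication by a letter on the left. -/
theorem exists_schreier_transversal (v₀ : V) (htrans : ∀ v : V, ∃ g : FreeGroup ι, g • v₀ = v) :
    ∃ t : V → FreeGroup ι, t v₀ = 1 ∧ (∀ v, t v • v₀ = v) ∧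
      ∀ C : V → Prop, C v₀ → (∀ v i, C v → t (FreeGroup.of i • v) = FreeGroup.of i * t v →
        C (FreeGroup.of i • v)) →
        (∀ v i, C (FreeGroup.of i • v) → t (FreeGroup.of i • v) = FreeGroup.of i * t v →
        C v) → ∀ v, C v := by
  classical
  let d : V → ℕ := fun v => sInf {m | ∃ g : FreeGroup ι, g • v₀ = v ∧ g.norm = m}
  have hd : ∀ v, ∃ g : FreeGroup ι, g • v₀ = v ∧ g.norm = d v := fun v => by
    obtain ⟨g, hg⟩ := htrans v
    exact Nat.sInf_mem (s := {m | ∃ g : FreeGroup ι, g • v₀ = v ∧ g.norm = m}) ⟨_, g, hg, rfl⟩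
  have hd' : ∀ (v : V) (g : FreeGroup ι), g • v₀ = v → d v ≤ g.norm := fun v g hg => Nat.sInf_le ⟨g, hg, rfl⟩
  -- Deleting the first letter of a shortest word leading from `v₀` to `v` gives a vertex closer to
  -- `v₀`; `t` is then defined by recursion on this distance.
  have step : ∀ v, v ≠ v₀ → ∃ (l : ι × Bool) (v' : V), d v' < d v ∧ FreeGroup.mk [l] • v' = v := by
    intro v hv
    obtain ⟨g, hg, hn⟩ := hd v
    rcases hw : g.toWord with _ | ⟨l, w⟩
    · rw [FreeGroup.toWord_eq_nil_iff] at hw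
      subst hw
      exact absurd (by simpa using hg.symm) hv
    · refine ⟨l, FreeGroup.mk w • v₀, ?_, ?_⟩
      · calc d (FreeGroup.mk w • v₀) ≤ (FreeGroup.mk w).norm := hd' _ _ rfl
          _ ≤ w.length := FreeGroup.norm_mk_le
          _ < g.norm := by simp [FreeGroup.norm, hw]
          _ = d v := hn
      · rw [smul_smul, FreeGroup.mul_mk, ← hg]
        conv_rhs => rw [← FreeGroup.mk_toWord (x := g), hw]
        rfl
  choose l p hp hlp using step
  let t : V → FreeGroup ι := (measure d).wf.fix fun v rec =>
    if h : v = v₀ then 1 else FreeGroup.mk [l v h] * rec (p v h) (hp v h)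
  have ht : ∀ v, t v = if h : v = v₀ then 1 else FreeGroup.mk [l v h] * t (p v h) := fun v => by
    simp only [t]
    rw [WellFounded.fix_eq]
  have hmk : ∀ i, FreeGroup.mk [(i, false)] = (FreeGroup.of i : FreeGroup ι)⁻¹ := fun i => by
    simp [FreeGroup.of, FreeGroup.invRev]
  refine ⟨t, by rw [ht, dif_pos rfl], fun v => ?_, fun C h₀ hpos hneg v => ?_⟩
  · induction v using (measure d).wf.induction with
    | _ v ih =>
      rw [ht]
      split_ifs with h
      · simp [h]
      · rw [mul_smul, ih _ (hp v h), hlp v h]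
  · induction v using (measure d).wf.induction with
    | _ v ih =>
      by_cases h : v = v₀
      · rwa [h]
      have h1 := ih _ (hp v h)
      have h2 := hlp v h
      have h3 := ht v
      rw [dif_neg h] at h3
      rcases hl : l v h with ⟨i, _ | _⟩
      · rw [hl, hmk] at h2 h3
        have h4 : FreeGroup.of i • v = p v h := (inv_smul_eq_iff.1 h2).symm
        exact hneg v i (by rwa [h4]) (by rw [h4, h3, mul_inv_cancel_left])
      · rw [hl] at h2 h3
        change FreeGroup.of i • p v h = v at h2
        change t v = FreeGroup.of i * t (p v h) at h3
        have := hpos (p v h) i h1 (by rwa [h2])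
        rwa [h2] at this

/-- The permutation of `V × X` by which a letter acts, given a labelling of the edges of the action
graph on `V` by elements of `X`. -/
def labelPerm {X : Type} [Group X] (f : ι → V → X) (i : ι) : Equiv.Perm (V × X) where
  toFun a := (FreeGroup.of i • a.1, f i a.1 * a.2)
  invFun a := ((FreeGroup.of i : FreeGroup ι)⁻¹ • a.1, (f i ((FreeGroup.of i)⁻¹ • a.1))⁻¹ * a.2)
  left_inv a := by simp
  right_inv a := by simp

/-- A labelling of the edges of the action graph extends to a cocycle. -/
theorem exists_cocycle {X : Type} [Group X] (f : ι → V → X) :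
    ∃ c : FreeGroup ι → V → X, (∀ i v, c (FreeGroup.of i) v = f i v) ∧
      ∀ g h v, c (g * h) v = c g (h • v) * c h v := by
  -- The letters act on `V × X` by permutations over the action on `V`. The action commutes with
  -- right multiplication on `X`, so the second coordinate of the image of `(v, 1)` is a cocycle.
  let ρ : FreeGroup ι →* Equiv.Perm (V × X) := FreeGroup.lift (labelPerm f)
  have hof : ∀ i a, ρ (FreeGroup.of i) a = (FreeGroup.of i • a.1, f i a.1 * a.2) := fun i a => by
    simp [ρ, labelPerm]
  have hinv : ∀ i a, ρ (FreeGroup.of i)⁻¹ a =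
      ((FreeGroup.of i : FreeGroup ι)⁻¹ • a.1, (f i ((FreeGroup.of i)⁻¹ • a.1))⁻¹ * a.2) :=
    fun i a => by
      rw [map_inv, Equiv.Perm.inv_eq_iff_eq, hof]
      simp
  have hfst : ∀ g a, (ρ g a).1 = g • a.1 := by
    intro g
    induction g using FreeGroup.induction_on with
    | C1 => simp
    | of i => simp [hof]
    | inv_of i _ => intro a; rw [hinv]
    | mul g h hg hh => intro a; rw [map_mul, Equiv.Perm.mul_apply, hg, hh, mul_smul]
  have hsnd : ∀ g v x, (ρ g (v, x)).2 = (ρ g (v, 1)).2 * x := by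
    intro g
    induction g using FreeGroup.induction_on with
    | C1 => simp
    | of i => simp [hof]
    | inv_of i _ => intro v x; rw [hinv, hinv, mul_one]
    | mul g h hg hh =>
      intro v x
      have e : ∀ y, ρ h (v, y) = (h • v, (ρ h (v, y)).2) := fun y => Prod.ext (hfst h _) rfl
      rw [map_mul, Equiv.Perm.mul_apply, Equiv.Perm.mul_apply, e x, e 1, hg, hh, ← mul_assoc,
        ← hg]
  refine ⟨fun g v => (ρ g (v, 1)).2, fun i v => by simp [hof], fun g h v => ?_⟩
  have e : ρ h (v, 1) = (h • v, (ρ h (v, 1)).2) := Prod.ext (hfst h _) rfl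
  simp only [map_mul, Equiv.Perm.mul_apply]
  conv_lhs => rw [e]
  exact hsnd _ _ _

/-- The cocycle `h g v = (t (g • v))⁻¹ * g * t v` is the identity of `H` at the base coset, and its
non-trivial values on letters form the Schreier basis. As `t v₀ = 1`, a letter lying in `H` is its
own value at `v₀`, so it belongs to this basis. -/
theorem exists_basis_extending_free (H : Subgroup (FreeGroup ι)) :
    ∃ (κ : Type) (c : FreeGroupBasis κ H),
      ∀ i, FreeGroup.of i ∈ H → ∃ k, (c k : FreeGroup ι) = FreeGroup.of i := by
  classical
  let v₀ : FreeGroup ι ⧸ H := (1 : FreeGroup ι)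
  have hstab : ∀ g : FreeGroup ι, g • v₀ = v₀ ↔ g ∈ H := fun g => by
    change ((g * 1 : FreeGroup ι) : FreeGroup ι ⧸ H) = ((1 : FreeGroup ι) : FreeGroup ι ⧸ H) ↔ _
    rw [eq_comm, QuotientGroup.eq]
    simp
  obtain ⟨t, ht1, ht, hind⟩ := exists_schreier_transversal v₀ fun v => by
    obtain ⟨g, rfl⟩ := QuotientGroup.mk_surjective v
    exact ⟨g, by change ((g * 1 : FreeGroup ι) : FreeGroup ι ⧸ H) = _; rw [mul_one]⟩
  have hmem : ∀ (g : FreeGroup ι) v, (t (g • v))⁻¹ * g * t v ∈ H := fun g v => by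
    rw [← hstab, mul_smul, mul_smul, ht, inv_smul_eq_iff, ht]
  let h : FreeGroup ι → FreeGroup ι ⧸ H → H := fun g v => ⟨(t (g • v))⁻¹ * g * t v, hmem g v⟩
  have hmul : ∀ g g' v, h (g * g') v = h g (g' • v) * h g' v := fun g g' v =>
    Subtype.ext (by simp [h, mul_smul, mul_assoc])
  have hself : ∀ x : H, h x v₀ = x := fun x => Subtype.ext (by
    simp [h, (hstab x).2 x.2, ht1])
  let κ := {e : ι × (FreeGroup ι ⧸ H) // h (FreeGroup.of e.1) e.2 ≠ 1}
  -- A cocycle is determined by its values on the letters.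
  have huniq : ∀ {X : Type} [Group X] (c c' : FreeGroup ι → FreeGroup ι ⧸ H → X),
      (∀ i v, c (FreeGroup.of i) v = c' (FreeGroup.of i) v) →
      (∀ g h v, c (g * h) v = c g (h • v) * c h v) →
      (∀ g h v, c' (g * h) v = c' g (h • v) * c' h v) → ∀ g v, c g v = c' g v := by
    intro X _ c c' hof hc hc' g
    have one : ∀ {c : FreeGroup ι → FreeGroup ι ⧸ H → X},
        (∀ g h v, c (g * h) v = c g (h • v) * c h v) → ∀ v, c 1 v = 1 := fun hc v => by
      simpa using hc 1 1 v
    have inv : ∀ {c : FreeGroup ι → FreeGroup ι ⧸ H → X},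
        (∀ g h v, c (g * h) v = c g (h • v) * c h v) → ∀ g v, c g⁻¹ v = (c g (g⁻¹ • v))⁻¹ :=
      fun {c} hc g v => by
        have := hc g g⁻¹ v
        rw [mul_inv_cancel, one hc] at this
        exact eq_inv_of_mul_eq_one_right this.symm
    induction g using FreeGroup.induction_on with
    | C1 => intro v; rw [one hc, one hc']
    | of i => exact hof i
    | inv_of i ih => intro v; rw [inv hc, inv hc', ih]
    | mul g h hg hh => intro v; rw [hc, hc', hg, hh]
  refine ⟨κ, ofUniqueLift κ (fun e => h (FreeGroup.of e.1.1) e.1.2) ?_, ?_⟩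
  · intro X _ f
    -- Labels are `f` on the Schreier generators and 1 on the tree edges. The resulting cocycle is
    -- trivial on the transversal, and at `v₀` it restricts to the homomorphism extending `f`.
    obtain ⟨c, hc, hcmul⟩ := exists_cocycle (V := FreeGroup ι ⧸ H) (X := X) fun i v =>
      if he : h (FreeGroup.of i) v ≠ 1 then f ⟨(i, v), he⟩ else 1
    have htree : ∀ v i, t (FreeGroup.of i • v) = FreeGroup.of i * t v →
        c (FreeGroup.of i) v = 1 := fun v i hv => by
      rw [hc, dif_neg]
      simp [h, hv]
    have hc1 : ∀ v, c 1 v = 1 := fun v => by simpa using hcmul 1 1 v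
    have hct : ∀ v, c (t v) v₀ = 1 := by
      refine hind _ (by rw [ht1, hc1]) (fun v i hv he => ?_) (fun v i hv he => ?_)
      · rw [he, hcmul, hv, ht, htree v i he, one_mul]
      · rw [he, hcmul, ht, htree v i he, one_mul] at hv
        exact hv
    let F : H →* X := MonoidHom.mk' (fun x => c x v₀) fun x y => by
      simp [hcmul, (hstab y).2 y.2]
    have hF : ∀ g v, F (h g v) = c g v := fun g v => by
      have e1 : t (g • v) * ((h g v : H) : FreeGroup ι) = g * t v := by simp [h, mul_assoc]
      have e2 := congrArg (fun z => c z v₀) e1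
      simp only [hcmul, ht, hct, mul_one, (hstab _).2 (h g v).2, one_mul] at e2
      exact e2
    refine ⟨F, fun e => ?_, fun E hE => ?_⟩
    · rw [hF, hc, dif_pos e.2]
    · ext x
      -- Any other extension `E` gives the cocycle `E ∘ h` with the same values on letters.
      have := huniq (fun g v => E (h g v)) c (fun i v => by
        rw [hc]
        split_ifs with he
        · exact hE ⟨(i, v), he⟩
        · rw [not_not.1 he, map_one]) (fun g g' v => by simp only [hmul, map_mul]) hcmul x v₀
      simp only [hself] at this
      exact this
  · intro i hi
    have e : h (FreeGroup.of i) v₀ = ⟨FreeGroup.of i, hi⟩ := hself ⟨_, hi⟩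
    refine ⟨⟨(i, v₀), ?_⟩, ?_⟩
    · rw [e]
      exact fun h' => FreeGroup.of_ne_one i (congrArg Subtype.val h')
    · rw [ofUniqueLift_apply, e]

end Schreier

end FreeGroupBasis

/-! ### Free factors and common bases -/

namespace FreeGroupBasis

theorem exists_basis_extending {ι G : Type} [Group G] (b : FreeGroupBasis ι G) (H : Subgroup G) :
    ∃ (κ : Type) (c : FreeGroupBasis κ H), ∀ i, b i ∈ H → ∃ k, (c k : G) = b i := by
  obtain ⟨κ, c, hc⟩ := exists_basis_extending_free (H.map b.repr.toMonoidHom)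
  refine ⟨κ, c.map (b.repr.subgroupMap H).symm, fun i hi => ?_⟩
  obtain ⟨k, hk⟩ := hc i ⟨b i, hi, by simp⟩
  refine ⟨k, b.repr.injective ?_⟩
  have h : ∀ x, b.repr ((b.repr.subgroupMap H).symm x : H) = x := fun x => by
    obtain ⟨y, rfl⟩ := (b.repr.subgroupMap H).surjective x
    simp
  exact (h (c k)).trans (hk.trans (b.repr_apply_coe i).symm)

theorem span_reindex {ι κ G : Type*} [Group G] (b : FreeGroupBasis ι G) (e : ι ≃ κ) (S : Set ι) :
    (b.reindex e).span (e '' S) = b.span S := by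
  rw [span, span, Set.image_image]
  simp

theorem coe_span {ι G : Type*} [Group G] {A : Subgroup G} (c : FreeGroupBasis ι A) (S : Set ι) :
    (c.span S).map A.subtype = Subgroup.closure ((fun i => (c i : G)) '' S) := by
  rw [span, MonoidHom.map_closure, Set.image_image]
  rfl

theorem span_inl_image {ι κ G : Type*} [Group G] {A : Subgroup G} (b : FreeGroupBasis (ι ⊕ κ) G)
    (c : FreeGroupBasis ι A) (h : ∀ i, b (Sum.inl i) = c i) (S : Set ι) :
    b.span (Sum.inl '' S) = (c.span S).map A.subtype := by
  rw [coe_span, span, Set.image_image]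
  simp only [h]

theorem span_inl {ι κ G : Type*} [Group G] {A : Subgroup G} (b : FreeGroupBasis (ι ⊕ κ) G)
    (c : FreeGroupBasis ι A) (h : ∀ i, b (Sum.inl i) = c i) :
    b.span (Set.range Sum.inl) = A := by
  rw [← Set.image_univ, span_inl_image b c h, span_univ, ← MonoidHom.range_eq_map,
    Subgroup.range_subtype]

theorem isFreeFactor_span {ι G : Type*} [Group G] (b : FreeGroupBasis ι G) (S : Set ι) :
    IsFreeFactor (b.span S) :=
  ⟨b.span Sᶜ, b.bijective_coprod_span S⟩

/-- A free factor is spanned by part of a basis. -/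
theorem exists_span_eq {ι G : Type} [Group G] (b : FreeGroupBasis ι G) {A : Subgroup G}
    (hA : IsFreeFactor A) : ∃ (c : FreeGroupBasis ι G) (S : Set ι), c.span S = A := by
  obtain ⟨B, hB⟩ := hA
  -- Only freeness of the two factors is used here; their bases together form a basis, indexed by
  -- `ι` up to a bijection.
  obtain ⟨κ, c, -⟩ := b.exists_basis_extending A
  obtain ⟨μ, d, -⟩ := b.exists_basis_extending B
  obtain ⟨x, hx, -⟩ := exists_basis_of_coprod hB c d
  obtain ⟨e⟩ := x.nonempty_equiv b
  exact ⟨x.reindex e, _, by rw [span_reindex, x.span_inl c hx]⟩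

/-- Nested free factors are spanned by parts of a common basis. -/
theorem exists_span_eq_of_le {ι G : Type} [Group G] (b : FreeGroupBasis ι G) {A B : Subgroup G}
    (hA : IsFreeFactor A) (hB : IsFreeFactor B) (h : A ≤ B) :
    ∃ (c : FreeGroupBasis ι G) (S T : Set ι), c.span S = A ∧ c.span T = B := by
  obtain ⟨a, S, rfl⟩ := b.exists_span_eq hA
  -- The part of `a` spanning the smaller factor lies in `B`, so it survives in the new basis of
  -- `B`, which a basis of a complement completes.
  obtain ⟨κ, c, hc⟩ := a.exists_basis_extending B
  obtain ⟨B', hB'⟩ := hB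
  obtain ⟨μ, d, -⟩ := b.exists_basis_extending B'
  obtain ⟨x, hx, -⟩ := exists_basis_of_coprod hB' c d
  obtain ⟨e⟩ := x.nonempty_equiv b
  refine ⟨x.reindex e, e '' (Sum.inl '' {k | ∃ i ∈ S, (c k : G) = a i}), _, ?_,
    by rw [span_reindex, x.span_inl c hx]⟩
  rw [span_reindex, x.span_inl_image c hx, coe_span, span]
  congr 1
  ext y
  constructor
  · rintro ⟨k, ⟨i, hi, hk⟩, rfl⟩
    exact ⟨i, hi, hk.symm⟩
  · rintro ⟨i, hi, rfl⟩
    obtain ⟨k, hk⟩ := hc i (h (a.mem_span hi))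
    exact ⟨k, ⟨i, hi, hk⟩, hk⟩

/-- A basis vector and a part of a basis generating a complementary free factor form a basis. -/
theorem exists_basis_exchange {ι κ G : Type*} [Group G] (b : FreeGroupBasis ι G)
    (c : FreeGroupBasis κ G) {S : Set ι} {T : Set κ} (h : b.span Sᶜ = c.span T) :
    ∃ x : FreeGroupBasis (S ⊕ T) G, (∀ i, x (Sum.inl i) = b i) ∧ ∀ i, x (Sum.inr i) = c i := by
  have hb := b.bijective_coprod_span S
  rw [h] at hb
  obtain ⟨b', hb'⟩ := b.exists_basis_span S
  obtain ⟨c', hc'⟩ := c.exists_basis_span T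
  obtain ⟨x, hx, hx'⟩ := exists_basis_of_coprod hb b' c'
  exact ⟨x, fun i => (hx i).trans (hb' i), fun i => (hx' i).trans (hc' i)⟩

/-- An element of a basis of `G` contained in a free factor complementary to a basis element `b j`
forms with it part of a basis of `G`. -/
theorem exists_join {ι G : Type} [Group G] (b : FreeGroupBasis ι G) {j : ι} {Q : Subgroup G}
    (hQ : IsFreeFactor Q) (hQL : Q ≤ b.span {j}ᶜ) :
    ∃ (x : FreeGroupBasis ι G) (S : Set ι) (k : ι), x.span S = Q ∧ x k = b j ∧ k ∉ S := by
  obtain ⟨c, S, T, hS, hT⟩ := b.exists_span_eq_of_le hQ (b.isFreeFactor_span _) hQL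
  -- In a basis adapted to `Q` and the corank one factor, the part outside that factor is replaced
  -- by `b j`.
  obtain ⟨x, hx, hx'⟩ := b.exists_basis_exchange c hT.symm
  obtain ⟨e⟩ := x.nonempty_equiv b
  have hST : S ⊆ T := by rw [← c.span_le_span_iff, hS, hT]; exact hQL
  refine ⟨x.reindex e, e '' (Sum.inr '' {i : T | (i : ι) ∈ S}), e (Sum.inl ⟨j, rfl⟩), ?_, ?_, ?_⟩
  · rw [span_reindex, ← hS, span, span, Set.image_image]
    congr 1
    ext y
    constructor
    · rintro ⟨i, hi, rfl⟩
      exact ⟨i, hi, (hx' i).symm⟩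
    · rintro ⟨i, hi, rfl⟩
      exact ⟨⟨i, hST hi⟩, hi, hx' _⟩
  · simp [hx]
  · simp

theorem nonempty_basis_span_iff {n i : ℕ} {G : Type*} [Group G] (b : FreeGroupBasis (Fin n) G)
    (S : Finset (Fin n)) :
    Nonempty (FreeGroupBasis (Fin i) (b.span S)) ↔ i = S.card := by
  obtain ⟨c, -⟩ := b.exists_basis_span S
  constructor
  · rintro ⟨d⟩
    obtain ⟨e⟩ := d.nonempty_equiv c
    simpa using Fintype.card_congr e
  · rintro rfl
    exact ⟨c.reindex (S.equivFin)⟩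

end FreeGroupBasis

/-! ### Reduced words of finitely generated subgroups -/

namespace FreeGroup

variable {ι : Type*} [DecidableEq ι]

theorem mem_closure_of_image_iff {S : Set ι} {w : FreeGroup ι} :
    w ∈ Subgroup.closure (of '' S) ↔ ∀ l ∈ w.toWord, l.1 ∈ S := by
  constructor
  · intro h
    induction h using Subgroup.closure_induction with
    | mem x hx =>
      obtain ⟨i, hi, rfl⟩ := hx
      simpa using hi
    | one => simp
    | mul x y _ _ hx hy =>
      intro l hl
      rcases List.mem_append.1 ((toWord_mul_sublist x y).subset hl) with h | h
      · exact hx l h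
      · exact hy l h
    | inv x _ hx =>
      intro l hl
      rw [toWord_inv, invRev, List.mem_reverse, List.mem_map] at hl
      obtain ⟨a, ha, rfl⟩ := hl
      exact hx a ha
  · intro h
    rw [← mk_toWord (x := w)]
    generalize w.toWord = W at h
    induction W with
    | nil => exact Subgroup.one_mem _
    | cons l W ih =>
      have h1 : mk (l :: W) = mk [l] * mk W := by rw [mul_mk]; rfl
      rw [h1]
      refine Subgroup.mul_mem _ ?_ (ih fun a ha => h a (List.mem_cons_of_mem _ ha))
      have h2 : of l.1 ∈ Subgroup.closure (of '' S) :=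
        Subgroup.subset_closure ⟨_, h l List.mem_cons_self, rfl⟩
      rcases l with ⟨i, _ | _⟩
      · simpa [of, invRev] using Subgroup.inv_mem _ h2
      · exact h2

theorem prefix_append_cases {α : Type*} {p A B : List α} (h : p <+: A ++ B) :
    p <+: A ∨ ∃ s, p = A ++ s ∧ s <+: B := by
  rcases List.prefix_or_prefix_of_prefix h (List.prefix_append A B) with h1 | ⟨s, rfl⟩
  · exact Or.inl h1
  · exact Or.inr ⟨s, rfl, (List.prefix_append_right_inj A).1 h⟩

/-- The reduced words of a finitely generated subgroup only visit finitely many cosets. -/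
theorem exists_finite_cosets {L : Subgroup (FreeGroup ι)} (hL : L.FG) :
    ∃ V : Set (FreeGroup ι ⧸ L), V.Finite ∧
      ∀ w ∈ L, ∀ p, p <+: w.toWord → (((mk p)⁻¹ : FreeGroup ι) : FreeGroup ι ⧸ L) ∈ V := by
  obtain ⟨X, rfl⟩ := hL
  set L := Subgroup.closure (X : Set (FreeGroup ι))
  let c : FreeGroup ι → FreeGroup ι ⧸ L := fun g => ((g⁻¹ : FreeGroup ι) : FreeGroup ι ⧸ L)
  have hc : ∀ x ∈ L, ∀ g, c (x * g) = c g := fun x hx g => by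
    rw [QuotientGroup.eq]
    simpa using hx
  -- The right cosets `L p`, written as `p⁻¹ L`, of all prefixes `p` of the generators.
  let V : Set (FreeGroup ι ⧸ L) :=
    insert (c 1) (⋃ x ∈ X, (fun p => c (mk p)) '' {p | p ∈ x.toWord.inits})
  refine ⟨V, ?_, ?_⟩
  · refine Set.Finite.insert _ (Set.Finite.biUnion X.finite_toSet fun x _ => Set.Finite.image _ ?_)
    exact List.finite_toSet _
  let Q : List (ι × Bool) → Prop := fun W => ∀ p, p <+: W → c (mk p) ∈ V
  have happ : ∀ W W', mk W ∈ L → Q W → Q W' → Q (W ++ W') := by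
    intro W W' hW h h' p hp
    rcases prefix_append_cases hp with h1 | ⟨s, rfl, h1⟩
    · exact h p h1
    · rw [← mul_mk, hc _ hW]
      exact h' s h1
  have hstep : ∀ W W', Red.Step W W' → Q W → Q W' := by
    rintro _ _ (@⟨A, B, x, b⟩) h p hp
    rcases prefix_append_cases hp with h1 | ⟨s, rfl, h1⟩
    · exact h p (h1.trans (List.prefix_append _ _))
    -- A prefix reaching beyond the cancelled pair represents the same element as the longer prefix
    -- that includes the pair.
    · have h2 := h (A ++ (x, b) :: (x, !b) :: s) (by
        rw [List.prefix_append_right_inj, List.cons_prefix_cons, List.cons_prefix_cons]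
        exact ⟨rfl, rfl, h1⟩)
      rwa [show mk (A ++ (x, b) :: (x, !b) :: s) = mk (A ++ s) from
        Quot.sound Red.Step.not] at h2
  have hred : ∀ W W', Red W W' → Q W → Q W' := by
    intro W W' h hW
    induction h with
    | refl => exact hW
    | tail _ h ih => exact hstep _ _ h ih
  intro w hw
  change Q w.toWord
  induction hw using Subgroup.closure_induction with
  | mem x hx =>
    intro p hp
    exact Or.inr (Set.mem_biUnion hx ⟨p, by simpa using hp, rfl⟩)
  | one =>
    intro p hp
    rw [toWord_one, List.prefix_nil] at hp
    subst hp
    exact Or.inl rfl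
  | mul x y hx hy h h' =>
    rw [toWord_mul]
    exact hred _ _ reduce.red (happ _ _ (by rwa [mk_toWord]) h h')
  | inv x hx h =>
    rintro p ⟨r, hr⟩
    rw [toWord_inv] at hr
    have h1 := congrArg invRev hr
    rw [invRev_invRev, invRev_append] at h1
    -- A prefix of the word of `x⁻¹` is `x⁻¹` times a prefix of the word of `x`, so it lies in a
    -- coset already visited.
    have h2 : mk p = x⁻¹ * mk (invRev r) := by
      rw [eq_inv_mul_iff_mul_eq]
      conv_lhs => rw [← mk_toWord (x := x), ← h1]
      rw [← mul_mk, ← inv_mk, ← inv_mk, inv_mul_cancel_right]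
    rw [h2, hc _ (Subgroup.inv_mem _ hx)]
    exact h _ ⟨_, h1⟩

/-- If no power of a generator is conjugate into a finitely generated subgroup, then the reduced words of
the subgroup do not contain high powers of this generator. -/
theorem exists_replicate_not_infix {L : Subgroup (FreeGroup ι)} (hL : L.FG) (i : ι)
    (hi : ∀ (p : FreeGroup ι) (m : ℕ), 0 < m → p * of i ^ m * p⁻¹ ∉ L) :
    ∃ k : ℕ, ∀ w ∈ L, ∀ s, ¬ List.replicate k (i, s) <:+: w.toWord := by
  obtain ⟨V, hV, h⟩ := exists_finite_cosets hL
  have := hV.fintype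
  refine ⟨Fintype.card V, ?_⟩
  rintro w hw s ⟨A, B, hAB⟩
  set k := Fintype.card V
  let y : FreeGroup ι := mk [(i, s)]
  have hy : ∀ m, mk (List.replicate m (i, s)) = y ^ m := fun m => by
    rw [pow_mk]
    congr 1
    simp
  have hmem : ∀ m : Fin (k + 1), (((mk A * y ^ (m : ℕ))⁻¹ : FreeGroup ι) : FreeGroup ι ⧸ L) ∈ V :=
    fun m => by
      have := h w hw (A ++ List.replicate m (i, s)) (by
        rw [← hAB, List.append_assoc, List.prefix_append_right_inj]
        refine ⟨List.replicate (k - m) (i, s) ++ B, ?_⟩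
        rw [← List.append_assoc, List.replicate_append_replicate,
          Nat.add_sub_cancel' (Nat.lt_succ_iff.1 m.2)])
      rwa [← mul_mk, hy] at this
  -- The `k + 1` prefixes ending inside the block lie in at most `k` cosets. A coincidence puts a
  -- conjugate of a positive power of the letter into `L`.
  obtain ⟨a, b, hab, he⟩ := Fintype.exists_ne_map_eq_of_card_lt
    (fun m => (⟨_, hmem m⟩ : V)) (by simp [k])
  have key : ∀ a b : ℕ, a < b → (((mk A * y ^ a)⁻¹ : FreeGroup ι) : FreeGroup ι ⧸ L)
      = (((mk A * y ^ b)⁻¹ : FreeGroup ι) : FreeGroup ι ⧸ L) → False := by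
    intro a b hab he
    obtain ⟨d, rfl⟩ := Nat.exists_eq_add_of_lt hab
    rw [eq_comm, QuotientGroup.eq] at he
    have h1 : mk A * y ^ (d + 1) * (mk A)⁻¹ ∈ L := by
      convert he using 1
      rw [show a + d + 1 = (d + 1) + a by omega, pow_add y (d + 1) a]
      group
    cases s
    · refine hi (mk A) (d + 1) d.succ_pos ?_
      have h2 : y = (of i)⁻¹ := by simp [y, of, invRev]
      have h3 := Subgroup.inv_mem _ h1
      rw [h2] at h3
      convert h3 using 1
      simp [mul_assoc]
    · exact hi (mk A) (d + 1) d.succ_pos h1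
  have he' := congrArg Subtype.val he
  rcases lt_or_gt_of_ne (Fin.val_ne_of_ne hab) with h1 | h1
  · exact key _ _ h1 he'
  · exact key _ _ h1 he'.symm

/-- Each letter of `w` cancels at most one letter of `A`, so `B` is never reached. The induction
needs the resulting bound on the length of `A'`. -/
theorem reduce_append_left (w A B : List (ι × Bool)) (h : IsReduced (A ++ B))
    (hw : w.length ≤ A.length) : ∃ A', reduce (w ++ (A ++ B)) = A' ++ B := by
  suffices ∃ A', reduce (w ++ (A ++ B)) = A' ++ B ∧ A.length ≤ A'.length + w.length by
    obtain ⟨A', h, -⟩ := this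
    exact ⟨A', h⟩
  induction w with
  | nil => exact ⟨A, h.reduce_eq, le_rfl⟩
  | cons l w ih =>
    simp only [List.length_cons] at hw
    obtain ⟨A', h1, h2⟩ := ih (by omega)
    rw [List.cons_append, reduce.cons, h1]
    rcases A' with _ | ⟨a, A'⟩
    · simp at h2
      omega
    · simp only [List.cons_append]
      split_ifs
      · exact ⟨A', rfl, by simp at h2 ⊢; omega⟩
      · exact ⟨l :: a :: A', rfl, by simp at h2 ⊢; omega⟩

theorem reduce_append_right (w B C : List (ι × Bool)) (h : IsReduced (B ++ C))
    (hw : w.length ≤ C.length) : ∃ C', reduce (B ++ C ++ w) = B ++ C' := by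
  obtain ⟨A', hA⟩ := reduce_append_left (invRev w) (invRev C) (invRev B)
    (by rw [← invRev_append, isReduced_iff_reduce_eq, reduce_invRev, h.reduce_eq])
    (by simpa using hw)
  refine ⟨invRev A', ?_⟩
  have := congrArg invRev hA
  rw [← invRev_append, ← invRev_append, reduce_invRev, invRev_invRev, invRev_append,
    invRev_invRev] at this
  exact this

/-- Multiplication by short elements does not change the middle of a reduced word. -/
theorem infix_toWord_mul (g h : FreeGroup ι) (A B C : List (ι × Bool))
    (hr : IsReduced (A ++ (B ++ C))) (hg : g.norm ≤ A.length) (hh : h.norm ≤ C.length) :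
    B <:+: (g * mk (A ++ (B ++ C)) * h).toWord := by
  obtain ⟨C', hC⟩ := reduce_append_right h.toWord (A ++ B) C (by rwa [List.append_assoc]) hh
  obtain ⟨A', hA⟩ := reduce_append_left g.toWord A (B ++ C')
    (by rw [← List.append_assoc, ← hC]; exact isReduced_iff_reduce_eq.2 reduce.idem) hg
  refine ⟨A', C', ?_⟩
  rw [mul_assoc, toWord_mul g, toWord_mul, toWord_mk, hr.reduce_eq, ← List.append_assoc A B C, hC,
    List.append_assoc A B C', hA, List.append_assoc]

end FreeGroup

/-! ### Transvections by high powers -/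

namespace FreeGroup

variable {ι : Type*} [DecidableEq ι]

/-- The endomorphism of a free group multiplying the generator `i` by `j ^ k` on the left. -/
def leftTransvection (i j : ι) (k : ℕ) : FreeGroup ι →* FreeGroup ι :=
  lift fun l => if l = i then of j ^ k * of l else of l

/-- The effect of `leftTransvection` on letters. -/
def transvectionLetter (i j : ι) (k : ℕ) (l : ι × Bool) : List (ι × Bool) :=
  if l.1 = i then
    if l.2 then List.replicate k (j, true) ++ [l] else l :: List.replicate k (j, false)
  else [l]

theorem mk_replicate (j : ι) (k : ℕ) : mk (List.replicate k (j, true)) = of j ^ k := by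
  rw [← toWord_of_pow, mk_toWord]

theorem leftTransvection_mk (i j : ι) (k : ℕ) (W : List (ι × Bool)) :
    leftTransvection i j k (mk W) = mk (W.flatMap (transvectionLetter i j k)) := by
  induction W with
  | nil => simp [← one_eq_mk]
  | cons l W ih =>
    have h1 : mk (l :: W) = mk [l] * mk W := by rw [mul_mk]; rfl
    have hinv : ∀ m : ι, mk [(m, false)] = (of m)⁻¹ := fun m => by simp [of, invRev]
    rw [h1, _root_.map_mul, ih, List.flatMap_cons, ← mul_mk]
    congr 1
    rcases l with ⟨m, _ | _⟩
    · rw [hinv, _root_.map_inv]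
      by_cases hm : m = i
      · have h2 : List.replicate k (j, false) = invRev (List.replicate k (j, true)) := by
          simp [invRev]
        have h3 : mk ((m, false) :: List.replicate k (j, false))
            = mk [(m, false)] * mk (List.replicate k (j, false)) := by rw [mul_mk]; rfl
        simp only [leftTransvection, lift_apply_of, transvectionLetter, hm, if_true,
          Bool.false_eq_true, if_false, mul_inv_rev]
        rw [hm] at h3
        rw [h3, hinv, h2, ← inv_mk, mk_replicate]
      · simp [leftTransvection, transvectionLetter, hm, hinv]
    · change leftTransvection i j k (of m) = _
      by_cases hm : m = i
      · simp only [leftTransvection, lift_apply_of, transvectionLetter, hm, if_true]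
        rw [← mul_mk, mk_replicate]
        rfl
      · simp [leftTransvection, transvectionLetter, hm]
        rfl

theorem transvectionLetter_cases (i j : ι) (k : ℕ) (l : ι × Bool) :
    transvectionLetter i j k l = [l] ∨
    l = (i, true) ∧ transvectionLetter i j k l = List.replicate k (j, true) ++ [l] ∨
    l = (i, false) ∧ transvectionLetter i j k l = l :: List.replicate k (j, false) := by
  rcases l with ⟨m, _ | _⟩ <;> by_cases hm : m = i <;> simp [transvectionLetter, hm]

/-- As `j` does not occur in `W`, an inserted block can only cancel against another block. Two
blocks with opposite signs meet only between `i⁻¹` and a following `i`, which a reduced word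
excludes. -/
theorem isReduced_flatMap_transvectionLetter {i j : ι} (hij : i ≠ j) (k : ℕ)
    {W : List (ι × Bool)} (hW : IsReduced W) (hj : ∀ l ∈ W, l.1 ≠ j) :
    IsReduced (W.flatMap (transvectionLetter i j k)) := by
  have hne : ∀ l, transvectionLetter i j k l ≠ [] := fun l => by
    rcases transvectionLetter_cases i j k l with h | ⟨-, h⟩ | ⟨-, h⟩ <;> rw [h] <;> simp
  have hrep : ∀ s, IsReduced (List.replicate k (j, s)) := fun s =>
    isReduced_iff_reduce_eq.2 (reduce_replicate k (j, s))
  have hlast : ∀ l, ∀ a ∈ (transvectionLetter i j k l).getLast?,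
      a = l ∨ l = (i, false) ∧ a = (j, false) := by
    intro l a ha
    rcases transvectionLetter_cases i j k l with h | ⟨-, h⟩ | ⟨hl, h⟩ <;> rw [h] at ha
    · exact Or.inl (by simpa using ha.symm)
    · exact Or.inl (by simpa using ha.symm)
    · rcases List.mem_cons.1 (List.mem_of_getLast? ha) with h1 | h1
      · exact Or.inl h1
      · exact Or.inr ⟨hl, List.eq_of_mem_replicate h1⟩
  have hhead : ∀ l, ∀ a ∈ (transvectionLetter i j k l).head?,
      a = l ∨ l = (i, true) ∧ a = (j, true) := by
    intro l a ha
    rcases transvectionLetter_cases i j k l with h | ⟨hl, h⟩ | ⟨-, h⟩ <;> rw [h] at ha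
    · exact Or.inl (by simpa using ha.symm)
    · rcases List.mem_append.1 (List.mem_of_mem_head? ha) with h1 | h1
      · exact Or.inr ⟨hl, List.eq_of_mem_replicate h1⟩
      · exact Or.inl (List.mem_singleton.1 h1)
    · exact Or.inl (by simpa using ha.symm)
  rw [List.flatMap_def, IsReduced, List.isChain_flatten (by simp [hne]), List.isChain_map]
  constructor
  · intro L hL
    obtain ⟨l, -, rfl⟩ := List.mem_map.1 hL
    rcases transvectionLetter_cases i j k l with h | ⟨hl, h⟩ | ⟨hl, h⟩ <;> rw [h]
    · exact List.isChain_singleton _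
    · refine List.IsChain.append (hrep true) (List.isChain_singleton _) ?_
      intro a ha b hb e
      rw [List.eq_of_mem_replicate (List.mem_of_getLast? ha)] at e
      have hb' : l = b := by simpa using hb
      rw [← hb', hl] at e
      exact absurd e.symm hij
    · rw [← List.singleton_append]
      refine List.IsChain.append (List.isChain_singleton _) (hrep false) ?_
      intro a ha b hb e
      rw [List.eq_of_mem_replicate (List.mem_of_mem_head? hb)] at e
      have ha' : l = a := by simpa using ha
      rw [← ha', hl] at e
      exact absurd e hij
  · refine List.IsChain.imp_of_mem_imp ?_ hW
    intro l l' hl hl' hll' a ha b hb e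
    rcases hlast l a ha with rfl | ⟨h1, rfl⟩ <;> rcases hhead l' b hb with rfl | ⟨h2, rfl⟩
    · exact hll' e
    · exact absurd e (hj _ hl)
    · exact absurd e.symm (hj _ hl')
    · rw [h1, h2] at hll'
      simp at hll'

/-- Let `L` be a finitely generated subgroup into which no power of the generator `j` is conjugate.
For large `k`, an element conjugate into `L` in the image under `leftTransvection i j k` of the
subgroup generated by the generators other than `j` comes from a conjugate of an element that does not
involve `i` either, and from such an element if it belongs to `L`. -/
theorem exists_transvection_avoiding {L : Subgroup (FreeGroup ι)} (hL : L.FG) {i j : ι}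
    (hij : i ≠ j) (hj : ∀ (p : FreeGroup ι) (m : ℕ), 0 < m → p * of j ^ m * p⁻¹ ∉ L) :
    ∃ k : ℕ, (∀ w ∈ Subgroup.closure (of '' {j}ᶜ), leftTransvection i j k w ∈ L →
        w ∈ Subgroup.closure (of '' {i, j}ᶜ)) ∧
      ∀ w ∈ Subgroup.closure (of '' {j}ᶜ), ∀ g, g * leftTransvection i j k w * g⁻¹ ∈ L →
        ∃ v ∈ Subgroup.closure (of '' {j}ᶜ), ∃ u ∈ Subgroup.closure (of '' {i, j}ᶜ),
          w = v * u * v⁻¹ := by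
  obtain ⟨k, hk⟩ := exists_replicate_not_infix hL j hj
  have hblock : ∀ W : List (ι × Bool), (∃ l ∈ W, l.1 = i) →
      ∃ s, List.replicate k (j, s) <:+: W.flatMap (transvectionLetter i j k) := by
    rintro W ⟨⟨m, s⟩, hl, rfl⟩
    refine ⟨s, List.IsInfix.trans ?_ (List.infix_flatMap_of_mem hl _)⟩
    cases s
    · simpa [transvectionLetter] using (List.suffix_cons _ _).isInfix
    · simpa [transvectionLetter] using (List.prefix_append _ _).isInfix
  have hmem : ∀ {w : FreeGroup ι}, (∀ l ∈ w.toWord, l.1 ≠ j) → (¬ ∃ l ∈ w.toWord, l.1 = i) →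
      w ∈ Subgroup.closure (of '' {i, j}ᶜ) := by
    intro w h1 h2
    rw [mem_closure_of_image_iff]
    intro l hl
    have h3 : l.1 ≠ i := fun h => h2 ⟨l, hl, h⟩
    simp [h3, h1 l hl]
  refine ⟨k, fun w hw hwL => ?_, fun w hw g hgw => ?_⟩
  · rw [mem_closure_of_image_iff] at hw
    refine hmem hw fun h => ?_
    obtain ⟨s, hs⟩ := hblock _ h
    refine hk _ hwL s ?_
    rw [← mk_toWord (x := w), leftTransvection_mk, toWord_mk,
      (isReduced_flatMap_transvectionLetter hij k isReduced_toWord hw).reduce_eq]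
    exact hs
  · rw [mem_closure_of_image_iff] at hw
    -- Write `w = C R C⁻¹` with `R` cyclically reduced. If `R` involves `i`, its image `U` contains
    -- a long block, and all powers of `U` are reduced as written.
    set C := reduceCyclically.conjugator w.toWord
    set R := reduceCyclically w.toWord
    have hw' : C ++ R ++ invRev C = w.toWord :=
      reduceCyclically.conj_conjugator_reduceCyclically _
    have hR : IsCyclicallyReduced R := reduceCyclically.isCyclicallyReduced isReduced_toWord
    have hCw : ∀ l ∈ C, l.1 ≠ j := fun l hl => hw l (by rw [← hw']; simp [hl])
    have hRw : ∀ l ∈ R, l.1 ≠ j := fun l hl => hw l (by rw [← hw']; simp [hl])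
    have hRred : R = (mk R).toWord := by rw [toWord_mk, hR.isReduced.reduce_eq]
    have hweq : w = mk C * mk R * (mk C)⁻¹ := by
      rw [inv_mk, mul_mk, mul_mk, hw', mk_toWord]
    refine ⟨mk C, ?_, mk R, hmem (by rwa [← hRred]) fun h => ?_, hweq⟩
    · rw [mem_closure_of_image_iff]
      intro l hl
      exact hCw l ((reduce.red (L := C)).sublist.subset (by rwa [toWord_mk] at hl))
    · rw [← hRred] at h
      obtain ⟨s, hs⟩ := hblock _ h
      set U := R.flatMap (transvectionLetter i j k)
      set f := g * leftTransvection i j k (mk C)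
      have hU1 : 1 ≤ U.length := by
        obtain ⟨l, hl, -⟩ := h
        rcases hne : U with _ | ⟨a, t⟩
        · have h1 : transvectionLetter i j k l = [] :=
            List.flatMap_eq_nil_iff.1 hne l hl
          rcases transvectionLetter_cases i j k l with h | ⟨-, h⟩ | ⟨-, h⟩ <;> simp [h] at h1
        · simp
      have hlen : ∀ N, N ≤ (List.replicate N U).flatten.length := fun N => by
        simp only [List.length_flatten, List.map_replicate, List.sum_replicate, smul_eq_mul]
        exact Nat.le_mul_of_pos_right N hU1
      have hpow : ∀ N, leftTransvection i j k (mk R ^ N) = mk (List.replicate N U).flatten := by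
        intro N
        rw [_root_.map_pow, leftTransvection_mk, pow_mk]
      have hred : ∀ N, IsReduced (List.replicate N U).flatten := fun N => by
        have h1 := isReduced_flatMap_transvectionLetter hij k (hR.flatten_replicate N).isReduced
          (by
            intro l hl
            obtain ⟨L', hL', hl'⟩ := List.mem_flatten.1 hl
            rw [List.eq_of_mem_replicate hL'] at hl'
            exact hRw l hl')
        convert h1 using 1
        rw [List.flatMap_def, List.map_flatten, List.flatten_flatten, List.map_map]
        simp [U, List.flatMap_def]
      have hfL : ∀ N : ℕ, f * mk (List.replicate N U).flatten * f⁻¹ ∈ L := fun N => by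
        have h1 := Subgroup.pow_mem _ hgw N
        rw [conj_pow, ← _root_.map_pow, hweq, conj_pow, _root_.map_mul, _root_.map_mul, hpow,
          _root_.map_inv] at h1
        convert h1 using 1
        simp only [f]
        group
      -- In `f * U ^ (2 * m + 1) * f⁻¹` the outer factors cancel at most `m` letters on either side,
      -- each copy of `U` has length at least 1, and so the middle copy survives.
      let m := f.norm
      have hsplit : (List.replicate (m + 1 + m) U).flatten
          = (List.replicate m U).flatten ++ (U ++ (List.replicate m U).flatten) := by
        rw [List.replicate_add, List.replicate_add, List.flatten_append, List.flatten_append]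
        simp
      have h1 := infix_toWord_mul f f⁻¹ (List.replicate m U).flatten U (List.replicate m U).flatten
        (by rw [← hsplit]; exact hred _) (hlen m) (by rw [norm_inv_eq]; exact hlen m)
      rw [← hsplit] at h1
      exact hk _ (hfL _) s (hs.trans h1)

end FreeGroup

/-! ### The transverse free factor of corank one -/

namespace FreeGroupBasis

theorem card_eq_of_span_eq {n : ℕ} {G : Type*} [Group G] {b c : FreeGroupBasis (Fin n) G}
    {S T : Finset (Fin n)} (h : b.span S = c.span T) : S.card = T.card := by
  have := (b.nonempty_basis_span_iff S).2 rfl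
  rw [h] at this
  exact (c.nonempty_basis_span_iff T).1 this

/-- Nested free factors of the same finite rank are equal. -/
theorem span_eq_of_le {n : ℕ} {G : Type} [Group G] {b c : FreeGroupBasis (Fin n) G}
    {S T : Finset (Fin n)} (h : b.span S ≤ c.span T) (hST : T.card ≤ S.card) :
    b.span S = c.span T := by
  classical
  obtain ⟨d, S', T', hS, hT⟩ :=
    b.exists_span_eq_of_le (b.isFreeFactor_span S) (c.isFreeFactor_span T) h
  have h1 : S'.toFinset ⊆ T'.toFinset := by
    rw [Set.toFinset_subset_toFinset, ← d.span_le_span_iff, hS, hT]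
    exact h
  have h2 : S.card = S'.toFinset.card := card_eq_of_span_eq (by rw [← hS, Set.coe_toFinset])
  have h3 : T.card = T'.toFinset.card := card_eq_of_span_eq (by rw [← hT, Set.coe_toFinset])
  rw [← hS, ← hT, Set.toFinset_inj.1 (Finset.eq_of_subset_of_card_le h1 (by omega))]

/-- The homomorphism to the integers which is the exponent sum of a basis element. -/
noncomputable def exponentSum {ι G : Type*} [Group G] (b : FreeGroupBasis ι G) (i : ι) :
    G →* Multiplicative ℤ :=
  open Classical in b.lift fun j => if j = i then Multiplicative.ofAdd 1 else 1

theorem exponentSum_self {ι G : Type*} [Group G] (b : FreeGroupBasis ι G) (i : ι) :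
    b.exponentSum i (b i) = Multiplicative.ofAdd 1 := by
  simp [exponentSum]

theorem exponentSum_of_ne {ι G : Type*} [Group G] (b : FreeGroupBasis ι G) {i j : ι}
    (h : j ≠ i) : b.exponentSum i (b j) = 1 := by
  simp [exponentSum, h]

theorem span_le_ker_exponentSum {ι G : Type*} [Group G] (b : FreeGroupBasis ι G) {i : ι}
    {S : Set ι} (h : i ∉ S) : b.span S ≤ (b.exponentSum i).ker :=
  b.span_le_ker fun _ hj => b.exponentSum_of_ne fun e => h (e ▸ hj)

/-- A basis can be changed so that a given nontrivial homomorphism to the integers is nontrivial on all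
basis elements but possibly a given one, which is kept. -/
theorem exists_hom_ne_one {ι G : Type*} [Group G] (b : FreeGroupBasis ι G) (k : ι)
    {f : G →* Multiplicative ℤ} (hf : f ≠ 1) :
    ∃ x : FreeGroupBasis ι G, x k = b k ∧ ∀ i, i ≠ k → f (x i) ≠ 1 := by
  classical
  obtain ⟨s, hs⟩ : ∃ s, f (b s) ≠ 1 := by
    by_contra! h
    exact hf (b.ext_hom _ _ h)
  obtain ⟨x, hx⟩ := b.exists_transvection s 0
    (fun i => if i = s ∨ i = k then 0 else if f (b i) = 1 then 1 else 0) rfl (by simp)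
  refine ⟨x, by simp [hx], fun i hi => ?_⟩
  rw [hx]
  by_cases his : i = s
  · subst his
    simpa using hs
  · by_cases h1 : f (b i) = 1 <;> simp [his, hi, h1, hs]

/-- Three homomorphisms to the integers in triangular position with respect to three elements do not
vanish simultaneously on a free factor of corank two. -/
theorem not_span_le_ker {n : ℕ} {G : Type*} [Group G] (e : FreeGroupBasis (Fin n) G)
    {S : Finset (Fin n)} (hS : S.card + 2 = n) {f₀ f₁ f₂ : G →* Multiplicative ℤ} {x₀ x₁ x₂ : G}
    (h00 : f₀ x₀ ≠ 1) (h01 : f₀ x₁ = 1) (h02 : f₀ x₂ = 1) (h11 : f₁ x₁ ≠ 1)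
    (h12 : f₁ x₂ = 1) (h22 : f₂ x₂ ≠ 1) (hk₀ : e.span S ≤ f₀.ker) (hk₁ : e.span S ≤ f₁.ker)
    (hk₂ : e.span S ≤ f₂.ker) : False := by
  obtain ⟨p, q, hpq, hc⟩ := Finset.card_eq_two.1 (show Sᶜ.card = 2 by
    rw [Finset.card_compl, Fintype.card_fin]; omega)
  have hcases : ∀ i, i ∈ S ∨ i = p ∨ i = q := fun i => by
    by_cases h : i ∈ S
    · exact Or.inl h
    · have : i ∈ Sᶜ := Finset.mem_compl.2 h
      rw [hc] at this
      simpa using Or.inr this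
  let a (f : G →* Multiplicative ℤ) (g : G) : ℤ := (f g).toAdd
  have hz : ∀ {f : G →* Multiplicative ℤ} {g}, a f g = 0 ↔ f g = 1 := fun {f g} => Iff.rfl
  -- The three homomorphisms vanish on `S`, so a linear relation that holds at `e p` and `e q` holds
  -- everywhere.
  have key : ∀ u v w : ℤ, u * a f₀ (e p) + v * a f₁ (e p) + w * a f₂ (e p) = 0 →
      u * a f₀ (e q) + v * a f₁ (e q) + w * a f₂ (e q) = 0 →
      ∀ g, u * a f₀ g + v * a f₁ g + w * a f₂ g = 0 := by
    intro u v w hp hq g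
    have h1 : ∀ g, (f₀ ^ u * f₁ ^ v * f₂ ^ w) g
        = Multiplicative.ofAdd (u * a f₀ g + v * a f₁ g + w * a f₂ g) := fun g => by
      apply Multiplicative.toAdd.injective
      simp [a, mul_comm]
    have h2 : f₀ ^ u * f₁ ^ v * f₂ ^ w = 1 := e.ext_hom _ _ fun i => by
      rw [h1]
      rcases hcases i with h | rfl | rfl
      · have m := e.mem_span (show i ∈ (S : Set (Fin n)) from h)
        rw [hz.2 (hk₀ m), hz.2 (hk₁ m), hz.2 (hk₂ m)]
        simp
      · rw [hp]
        rfl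
      · rw [hq]
        rfl
    have h3 := h1 g
    rw [h2] at h3
    exact (Multiplicative.ofAdd.injective h3).symm
  -- The coefficients are the cross product of the value vectors at `e p` and `e q`. At `x₂` only
  -- the last one remains, so the minor of `f₀` and `f₁` vanishes; the resulting relations at `x₁`
  -- then force `f₀ = 0`.
  have k1 := key (a f₁ (e p) * a f₂ (e q) - a f₁ (e q) * a f₂ (e p))
    (a f₂ (e p) * a f₀ (e q) - a f₂ (e q) * a f₀ (e p))
    (a f₀ (e p) * a f₁ (e q) - a f₀ (e q) * a f₁ (e p)) (by ring) (by ring) x₂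
  rw [hz.2 h02, hz.2 h12] at k1
  simp only [mul_zero, zero_add, mul_eq_zero] at k1
  have k2 := k1.resolve_right (mt hz.1 h22)
  have kp := key (a f₁ (e p)) (-a f₀ (e p)) 0 (by ring) (by linarith)
  have kq := key (a f₁ (e q)) (-a f₀ (e q)) 0 (by linarith) (by ring)
  have p0 := kp x₁
  have q0 := kq x₁
  rw [hz.2 h01] at p0 q0
  simp only [mul_zero, zero_add, zero_mul, add_zero, mul_eq_zero, neg_eq_zero] at p0 q0
  have p0 := p0.resolve_right (mt hz.1 h11)
  have q0 := q0.resolve_right (mt hz.1 h11)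
  have := key 1 0 0 (by simp [p0]) (by simp [q0]) x₀
  exact h00 (hz.1 (by simpa using this))

/-- A free factor `L` of corank one and a basis element `b k` are given. Some free factor of corank one
contains `b k` but has no free factor of corank two in common with `L`, even up to conjugacy, if `b k` is not in `L`,
respectively not conjugate into `L`. -/
theorem exists_transverse {n : ℕ} (hn : 3 ≤ n) {G : Type} [Group G]
    (a b : FreeGroupBasis (Fin n) G) (j k : Fin n) :
    ∃ (d : FreeGroupBasis (Fin n) G) (i : Fin n), i ≠ k ∧ d k = b k ∧
      (b k ∉ a.span {j}ᶜ → ∀ (e : FreeGroupBasis (Fin n) G) (S : Finset (Fin n)),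
        S.card + 2 = n → e.span S ≤ d.span {i}ᶜ → ¬ e.span S ≤ a.span {j}ᶜ) ∧
      ((∀ g, g * b k * g⁻¹ ∉ a.span {j}ᶜ) → ∀ (e : FreeGroupBasis (Fin n) G)
        (S : Finset (Fin n)), S.card + 2 = n → e.span S ≤ d.span {i}ᶜ →
        ∀ g, ¬ (e.span S).map (MulAut.conj g).toMonoidHom ≤ a.span {j}ᶜ) := by
  have hpick : ∀ s : Finset (Fin n), s.card < n → ∃ i, i ∉ s := fun s hs => by
    by_contra! h
    rw [← Finset.eq_univ_iff_forall] at h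
    simp [h] at hs
  set L := a.span {j}ᶜ with hLdef
  set χ := a.exponentSum j
  have hχ : χ ≠ 1 := fun h => by
    have h1 := a.exponentSum_self j
    change χ (a j) = _ at h1
    rw [h] at h1
    exact absurd (Multiplicative.ofAdd.injective h1) (by decide)
  have hLχ : L ≤ χ.ker := a.span_le_ker_exponentSum (by simp)
  -- As `χ` kills `L` and is non-trivial on every `x i` with `i ≠ k`, no positive power of such an
  -- `x i` is conjugate into `L`.
  obtain ⟨x, hxk, hxχ⟩ := b.exists_hom_ne_one k hχ
  obtain ⟨i₁, hi₁⟩ := hpick {k} (by simp; omega)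
  obtain ⟨i₀, hi₀⟩ := hpick {k, i₁} (lt_of_le_of_lt Finset.card_le_two (by omega))
  simp only [Finset.mem_insert, Finset.mem_singleton, not_or] at hi₀ hi₁
  have hLFG : (L.map x.repr.toMonoidHom).FG := by
    refine (Subgroup.fg_iff _).2 ⟨x.repr.toMonoidHom '' (a '' {j}ᶜ), ?_, ?_⟩
    · rw [hLdef, span, MonoidHom.map_closure]
    · exact ((Set.toFinite _).image _).image _
  have hmemL : ∀ y, x.repr y ∈ L.map x.repr.toMonoidHom ↔ y ∈ L := fun y =>
    Subgroup.mem_map_iff_mem x.repr.injective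
  obtain ⟨m, hm1, hm2⟩ := FreeGroup.exists_transvection_avoiding hLFG hi₀.2 (by
    intro p r hr hp
    obtain ⟨p, rfl⟩ := x.repr.surjective p
    rw [← x.repr_apply_coe, ← map_pow, ← map_inv, ← map_mul, ← map_mul, hmemL] at hp
    have h1 := hLχ hp
    rw [χ.mem_ker, map_mul, map_mul, map_inv, mul_inv_cancel_comm, map_pow] at h1
    exact hxχ i₁ hi₁ ((pow_eq_one_iff_left hr.ne').1 h1))
  -- The basis `d` is `x` with `x i₀` replaced by `x i₁ ^ m * x i₀`; the transverse factor is
  -- `d.span {i₁}ᶜ`.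
  obtain ⟨d, hd⟩ := x.exists_transvection i₁ (fun i => if i = i₀ then m else 0) 0
    (by simp [Ne.symm hi₀.2]) rfl
  have hdx : ∀ i, i ≠ i₀ → d i = x i := fun i hi => by simp [hd, hi]
  have hdσ : ∀ i, x.repr (d i) = FreeGroup.leftTransvection i₀ i₁ m (FreeGroup.of i) := fun i => by
    by_cases h : i = i₀ <;> simp [hd, FreeGroup.leftTransvection, h]
  have hM : ∀ y ∈ d.span {i₁}ᶜ, ∃ w ∈ Subgroup.closure (FreeGroup.of '' {i₁}ᶜ),
      x.repr y = FreeGroup.leftTransvection i₀ i₁ m w := by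
    intro y hy
    have h1 : d.span {i₁}ᶜ ≤ ((Subgroup.closure (FreeGroup.of '' {i₁}ᶜ)).map
        (FreeGroup.leftTransvection i₀ i₁ m)).comap x.repr.toMonoidHom :=
      d.span_le.2 fun i hi => ⟨FreeGroup.of i, Subgroup.subset_closure ⟨i, hi, rfl⟩,
        (hdσ i).symm⟩
    obtain ⟨w, hw, hwy⟩ := h1 hy
    exact ⟨w, hw, hwy.symm⟩
  have hK : ∀ u ∈ Subgroup.closure (FreeGroup.of '' ({i₀, i₁}ᶜ : Set (Fin n))),
      ∃ y ∈ x.span {i₀, i₁}ᶜ, x.repr y = FreeGroup.leftTransvection i₀ i₁ m u := by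
    intro u hu
    have h1 : Subgroup.closure (FreeGroup.of '' ({i₀, i₁}ᶜ : Set (Fin n))) ≤
        ((x.span {i₀, i₁}ᶜ).map x.repr.toMonoidHom).comap
          (FreeGroup.leftTransvection i₀ i₁ m) := by
      rw [Subgroup.closure_le]
      rintro _ ⟨i, hi, rfl⟩
      refine ⟨x i, x.mem_span hi, ?_⟩
      rw [← hdσ, hdx i fun h => hi (by simp [h])]
      rfl
    exact h1 hu
  have hKk : b k ∈ x.span ({i₀, i₁}ᶜ : Set (Fin n)) := by
    rw [← hxk]
    exact x.mem_span (by simp [Ne.symm hi₀.1, Ne.symm hi₁])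
  refine ⟨d, i₁, hi₁, by rw [hdx k (Ne.symm hi₀.1), hxk], fun hb e S hS hSd hSL => ?_,
    fun hb e S hS hSd g hSL => ?_⟩
  -- A common factor of corank two lies in `x.span {i₀, i₁}ᶜ`; the ranks agree, so the two are
  -- equal, and `b k` would lie in `L`.
  · have h1 : e.span S ≤ x.span (({i₀, i₁}ᶜ : Finset (Fin n)) : Set (Fin n)) := by
      intro y hy
      obtain ⟨w, hw, hwy⟩ := hM y (hSd hy)
      obtain ⟨z, hz, hzw⟩ := hK w (hm1 w hw (by rw [← hwy, hmemL]; exact hSL hy))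
      rw [← hwy] at hzw
      rwa [← x.repr.injective hzw, Finset.coe_compl, Finset.coe_pair]
    have h2 := span_eq_of_le h1 (by
      rw [Finset.card_compl, Finset.card_pair hi₀.2, Fintype.card_fin]; omega)
    refine hb (hSL ?_)
    rwa [h2, Finset.coe_compl, Finset.coe_pair]
  -- Up to conjugacy only the elements are controlled one by one. Homomorphisms to the integers that
  -- kill `x.span {i₀, i₁}ᶜ` therefore also kill `e.span S`.
  · have hconj : ∀ y ∈ e.span S, ∃ v, ∃ u ∈ x.span ({i₀, i₁}ᶜ : Set (Fin n)),
        y = v * u * v⁻¹ := by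
      intro y hy
      obtain ⟨w, hw, hwy⟩ := hM y (hSd hy)
      obtain ⟨v, -, u, hu, rfl⟩ := hm2 w hw (x.repr g) (by
        rw [← hwy, ← map_inv, ← map_mul, ← map_mul, hmemL]
        exact hSL ⟨y, hy, rfl⟩)
      obtain ⟨z, hz, hzu⟩ := hK u hu
      refine ⟨x.repr.symm (FreeGroup.leftTransvection i₀ i₁ m v), z, hz, x.repr.injective ?_⟩
      simp [hwy, hzu]
    have hker : ∀ f : G →* Multiplicative ℤ, x.span ({i₀, i₁}ᶜ : Set (Fin n)) ≤ f.ker →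
        e.span S ≤ f.ker := by
      intro f hf y hy
      obtain ⟨v, u, hu, rfl⟩ := hconj y hy
      have := f.mem_ker.1 (hf hu)
      simp [f.mem_ker, this]
    rcases Nat.lt_or_ge 3 n with hn4 | hn3
    -- For `n ≥ 4` a further index exists, and the exponent sums of `x i₀` and `x i₁` together with
    -- `χ` are three triangular homomorphisms vanishing on a factor of corank two.
    · obtain ⟨i₂, hi₂⟩ := hpick {k, i₀, i₁} (lt_of_le_of_lt Finset.card_le_three hn4)
      simp only [Finset.mem_insert, Finset.mem_singleton, not_or] at hi₂
      refine e.not_span_le_ker hS (f₀ := x.exponentSum i₀) (f₁ := x.exponentSum i₁) (f₂ := χ)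
        (x₀ := x i₀) (x₁ := x i₁) (x₂ := x i₂) ?_ (x.exponentSum_of_ne (Ne.symm hi₀.2))
        (x.exponentSum_of_ne hi₂.2.1) ?_
        (x.exponentSum_of_ne hi₂.2.2) (hxχ i₂ hi₂.1)
        (hker _ (x.span_le_ker_exponentSum (by simp)))
        (hker _ (x.span_le_ker_exponentSum (by simp))) ?_
      · rw [exponentSum_self]
        simp
      · rw [exponentSum_self]
        simp
      · intro y hy
        have h1 := hLχ (hSL ⟨y, hy, rfl⟩)
        simpa [χ.mem_ker] using h1
    -- For `n = 3` the common factor is generated by `e t`, which is conjugate to a power of `b k`.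
    -- The exponent sum of `e t` makes the exponent ±1, so `b k` is conjugate into `L`.
    · obtain ⟨t, rfl⟩ := Finset.card_eq_one.1 (show S.card = 1 by omega)
      have ht : e t ∈ e.span (({t} : Finset (Fin n)) : Set (Fin n)) := e.mem_span (by simp)
      obtain ⟨v, u, hu, hvu⟩ := hconj _ ht
      have hset : ({i₀, i₁}ᶜ : Set (Fin n)) ⊆ {k} := by
        intro i hi
        by_contra hik
        have h1 : ({i₀, i₁, k, i} : Finset (Fin n)).card ≤ n := by
          simpa using Finset.card_le_univ ({i₀, i₁, k, i} : Finset (Fin n))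
        simp only [Set.mem_compl_iff, Set.mem_insert_iff, Set.mem_singleton_iff, not_or] at hi hik
        rw [Finset.card_insert_of_notMem (by simp [hi₀, Ne.symm hi.1]),
          Finset.card_insert_of_notMem (by simp [hi₁, Ne.symm hi.2]),
          Finset.card_insert_of_notMem (by simp [Ne.symm hik]), Finset.card_singleton] at h1
        omega
      have hu' := x.span_mono hset hu
      rw [span, Set.image_singleton, hxk] at hu'
      obtain ⟨r, rfl⟩ := Subgroup.mem_closure_singleton.1 hu'
      have h1 := congrArg (fun y => (e.exponentSum t y).toAdd) hvu
      simp only [exponentSum_self, map_mul, map_inv, mul_inv_cancel_comm, map_zpow, toAdd_ofAdd,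
        toAdd_zpow] at h1
      have h2 : g * e t * g⁻¹ ∈ L := hSL ⟨e t, ht, rfl⟩
      rw [hvu] at h2
      rcases Int.isUnit_iff.1 (IsUnit.of_mul_eq_one _ h1.symm) with rfl | rfl
      · refine hb (g * v) ?_
        convert h2 using 1
        group
      · refine hb (g * v) ?_
        convert Subgroup.inv_mem _ h2 using 1
        group

end FreeGroupBasis

/-! ### Free factors as a framed order -/

theorem comparability_of_mem_simplicialAut {P : Type*} [Preorder P] {φ : Equiv.Perm P}
    (h : φ ∈ simplicialAut (orderComplex P)) : FramedOrder.Comparability φ := by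
  classical
  have hmem : ∀ a c : P, ({a, c} : Finset P) ∈ orderComplex P ↔ (a ≤ c ∨ c ≤ a) := by
    intro a c
    change (({a, c} : Finset P).Nonempty ∧ IsChain (· ≤ ·) (({a, c} : Finset P) : Set P)) ↔ _
    rw [Finset.coe_pair]
    constructor
    · rintro ⟨-, h⟩
      rcases eq_or_ne a c with rfl | hac
      · exact Or.inl le_rfl
      · exact h (by simp) (by simp) hac
    · intro h
      refine ⟨Finset.insert_nonempty _ _, ?_⟩
      rintro x (rfl | rfl) y (rfl | rfl) hxy
      · exact absurd rfl hxy
      · exact h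
      · exact h.symm
      · exact absurd rfl hxy
  intro a c
  rw [← hmem, ← hmem, ← h {a, c}]
  simp [Finset.map_insert]

namespace ProperFreeFactor

variable {n : ℕ}

/-- The free factor spanned by part of a basis. -/
def std (b : FreeGroupBasis (Fin n) (FreeGroup (Fin n))) (S : ProperSubset n) :
    ProperFreeFactor n :=
  ⟨b.span S.1, b.isFreeFactor_span _, fun h => by
    have h1 : b.span (S.1 : Set (Fin n)) ≤ b.span ∅ := h.le.trans bot_le
    rw [b.span_le_span_iff] at h1
    obtain ⟨i, hi⟩ := S.2.1
    exact h1 hi, fun h => by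
    have h1 : b.span Set.univ ≤ b.span (S.1 : Set (Fin n)) := le_top.trans h.ge
    rw [b.span_le_span_iff] at h1
    exact S.2.2 (Finset.eq_univ_iff_forall.2 fun i => h1 (Set.mem_univ i))⟩

theorem std_le_iff (b : FreeGroupBasis (Fin n) (FreeGroup (Fin n))) (S T : ProperSubset n) :
    std b S ≤ std b T ↔ S.1 ⊆ T.1 :=
  (b.span_le_span_iff (S := S.1) (T := T.1)).trans Finset.coe_subset

theorem std_eq {A : ProperFreeFactor n} {b : FreeGroupBasis (Fin n) (FreeGroup (Fin n))}
    {S : Set (Fin n)} (h : b.span S = A.1) : ∃ T : ProperSubset n, (T.1 : Set (Fin n)) = S ∧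
      std b T = A := by
  classical
  refine ⟨⟨S.toFinset, ?_, ?_⟩, Set.coe_toFinset S, Subtype.ext ?_⟩
  · rw [Set.toFinset_nonempty, Set.nonempty_iff_ne_empty]
    rintro rfl
    exact A.2.2.1 (by rw [← h]; simp [FreeGroupBasis.span])
  · intro h1
    rw [Set.toFinset_eq_univ] at h1
    subst h1
    exact A.2.2.2 (by rw [← h, b.span_univ])
  · simpa [std] using h

theorem exists_std_of_le {A B : ProperFreeFactor n} (h : A ≤ B) :
    ∃ b S T, std b S = A ∧ std b T = B := by
  obtain ⟨b, S, T, hS, hT⟩ := (FreeGroupBasis.ofFreeGroup (Fin n)).exists_span_eq_of_le A.2.1 B.2.1 h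
  obtain ⟨S', -, hS'⟩ := std_eq hS
  obtain ⟨T', -, hT'⟩ := std_eq hT
  exact ⟨b, S', T', hS', hT'⟩

theorem exists_std (A : ProperFreeFactor n) : ∃ b S, std b S = A := by
  obtain ⟨b, S, -, h, -⟩ := exists_std_of_le (le_refl A)
  exact ⟨b, S, h⟩

theorem std_mem_AFRank_iff {b : FreeGroupBasis (Fin n) (FreeGroup (Fin n))} {S : ProperSubset n}
    {i : ℕ} : std b S ∈ AFRank n i ↔ i = S.1.card :=
  b.nonempty_basis_span_iff S.1

/-- The rank of a free factor. -/
noncomputable def rk (A : ProperFreeFactor n) : ℕ := sInf {i | A ∈ AFRank n i}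

theorem rk_std (b : FreeGroupBasis (Fin n) (FreeGroup (Fin n))) (S : ProperSubset n) :
    rk (std b S) = S.1.card := by
  simp only [rk, std_mem_AFRank_iff, Set.ofPred_eq_eq_singleton, csInf_singleton]

theorem mem_AFRank_iff {A : ProperFreeFactor n} {i : ℕ} : A ∈ AFRank n i ↔ rk A = i := by
  obtain ⟨b, S, rfl⟩ := exists_std A
  rw [std_mem_AFRank_iff, rk_std, eq_comm]

theorem rk_pos (A : ProperFreeFactor n) : 1 ≤ rk A := by
  obtain ⟨b, S, rfl⟩ := exists_std A
  rw [rk_std]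
  exact S.2.1.card_pos

theorem rk_lt (A : ProperFreeFactor n) : rk A < n := by
  obtain ⟨b, S, rfl⟩ := exists_std A
  rw [rk_std]
  simpa using (Finset.card_lt_iff_ne_univ S.1).2 S.2.2

theorem exists_eq_cosingle (hn : 3 ≤ n) {L : ProperFreeFactor n} (hL : rk L = n - 1) :
    ∃ b j, L = std b (FramedOrder.cosingle hn j) := by
  obtain ⟨b, S, rfl⟩ := exists_std L
  rw [rk_std] at hL
  obtain ⟨j, hj⟩ := Finset.card_eq_one.1 (show S.1ᶜ.card = 1 by
    rw [Finset.card_compl, Fintype.card_fin]; omega)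
  refine ⟨b, j, ?_⟩
  congr 1
  exact Subtype.ext (compl_eq_comm.1 hj).symm

theorem exists_eq_single (hn : 3 ≤ n) {p : ProperFreeFactor n} (hp : rk p = 1) :
    ∃ b k, p = std b (FramedOrder.single hn k) := by
  obtain ⟨b, S, rfl⟩ := exists_std p
  rw [rk_std] at hp
  obtain ⟨k, hk⟩ := Finset.card_eq_one.1 hp
  exact ⟨b, k, by congr 1; exact Subtype.ext hk⟩

theorem coe_std_cosingle (hn : 3 ≤ n) (b : FreeGroupBasis (Fin n) (FreeGroup (Fin n))) (j : Fin n) :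
    (std b (FramedOrder.cosingle hn j)).1 = b.span {j}ᶜ := by
  simp [std, FramedOrder.cosingle]

theorem coe_std_single (hn : 3 ≤ n) (b : FreeGroupBasis (Fin n) (FreeGroup (Fin n))) (j : Fin n) :
    (std b (FramedOrder.single hn j)).1 = b.span {j} := by
  simp [std, FramedOrder.single]

theorem exists_join (hn : 3 ≤ n) (b : FreeGroupBasis (Fin n) (FreeGroup (Fin n))) (j : Fin n)
    {q : ProperFreeFactor n} (hq : rk q = 1) (hqL : q ≤ std b (FramedOrder.cosingle hn j)) :
    ∃ C, rk C = 2 ∧ std b (FramedOrder.single hn j) ≤ C ∧ q ≤ C := by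
  obtain ⟨x, S, k, hS, hk, hkS⟩ := b.exists_join (j := j) q.2.1 (by
    rw [← coe_std_cosingle hn]; exact hqL)
  obtain ⟨S', rfl, rfl⟩ := std_eq hS
  rw [rk_std] at hq
  have hc : (insert k S'.1).card = 2 := by
    rw [Finset.card_insert_of_notMem (by simpa using hkS), hq]
  let C : ProperSubset n := ⟨insert k S'.1, Finset.insert_nonempty _ _, fun h => by
    rw [h, Finset.card_univ, Fintype.card_fin] at hc
    omega⟩
  refine ⟨std x C, by rw [rk_std, hc], ?_, (std_le_iff _ _ _).2 (Finset.subset_insert _ _)⟩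
  change (std b (FramedOrder.single hn j)).1 ≤ x.span (insert k S'.1 : Finset (Fin n))
  rw [coe_std_single, b.span_le]
  rintro _ rfl
  rw [← hk]
  exact x.mem_span (by simp)

/-- The ordered set of free factors, with the frames given by the bases of the free group. -/
noncomputable def framedOrder (hn : 3 ≤ n) : FramedOrder (ProperFreeFactor n) n where
  Frame := FreeGroupBasis (Fin n) (FreeGroup (Fin n))
  rk := rk
  std := std
  rk_std := rk_std
  std_le_iff := std_le_iff
  adapted _ _ := exists_std_of_le
  joins L hL := by
    obtain ⟨b, j, rfl⟩ := exists_eq_cosingle hn hL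
    refine ⟨std b (FramedOrder.single hn j), by simp [rk_std, FramedOrder.single], ?_,
      fun q hq hqL => exists_join hn b j hq hqL⟩
    simp [std_le_iff, FramedOrder.single, FramedOrder.cosingle]
  transverse L p hL hp hpL := by
    obtain ⟨a, j, rfl⟩ := exists_eq_cosingle hn hL
    obtain ⟨b, k, rfl⟩ := exists_eq_single hn hp
    obtain ⟨d, i, hik, hdk, h, -⟩ := FreeGroupBasis.exists_transverse hn a b j k
    refine ⟨std d (FramedOrder.cosingle hn i), by simp [rk_std, FramedOrder.cosingle,
      Finset.card_compl], ?_, fun K hK hKM hKL => ?_⟩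
    · change (std b _).1 ≤ (std d _).1
      rw [coe_std_single, coe_std_cosingle, b.span_le]
      rintro _ rfl
      rw [← hdk]
      exact d.mem_span (by simpa using Ne.symm hik)
    · obtain ⟨e, S, rfl⟩ := exists_std K
      rw [rk_std] at hK
      refine h (fun hb => hpL ?_) e S.1 (by omega) (by rw [← coe_std_cosingle hn]; exact hKM)
        (by rw [← coe_std_cosingle hn]; exact hKL)
      change (std b _).1 ≤ (std a _).1
      rw [coe_std_single, coe_std_cosingle, b.span_le]
      rintro _ rfl
      exact hb

theorem conj_mem (g : FreeGroup (Fin n)) (A : ProperFreeFactor n) :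
    ∃ B : ProperFreeFactor n, B.1 = A.1.map (MulAut.conj g).toMonoidHom := by
  obtain ⟨b, S, rfl⟩ := exists_std A
  exact ⟨std (b.map (MulAut.conj g)) S, b.span_map _ _⟩

end ProperFreeFactor

/-! ### Conjugacy classes of free factors as a framed order -/

namespace FreeFactorClass

open ProperFreeFactor

variable {n : ℕ}

theorem exists_mk (a : FreeFactorClass n) : ∃ A, mk A = a :=
  Quotient.exists_rep a

theorem mk_eq_mk {A B : ProperFreeFactor n} :
    mk A = mk B ↔ ∃ g : FreeGroup (Fin n), A.1.map (MulAut.conj g).toMonoidHom = B.1 :=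
  Quotient.eq (r := conjSetoid n)

/-- Conjugating a nested pair allows the representative of the larger class to be prescribed, which
reduces `joins` to actual inclusions. -/
theorem le_mk_iff {a : FreeFactorClass n} {B : ProperFreeFactor n} :
    a ≤ mk B ↔ ∃ A, mk A = a ∧ A ≤ B := by
  constructor
  · rintro ⟨A, B', rfl, hB, hAB⟩
    obtain ⟨g, hg⟩ := mk_eq_mk.1 hB
    obtain ⟨A', hA'⟩ := conj_mem g A
    refine ⟨A', (mk_eq_mk.2 ⟨g, hA'.symm⟩).symm, ?_⟩
    change A'.1 ≤ B.1
    rw [hA', ← hg]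
    exact Subgroup.map_mono hAB
  · rintro ⟨A, rfl, h⟩
    exact ⟨A, B, rfl, rfl, h⟩

theorem mk_le_mk_iff {A B : ProperFreeFactor n} :
    mk A ≤ mk B ↔ ∃ g : FreeGroup (Fin n), A.1.map (MulAut.conj g).toMonoidHom ≤ B.1 := by
  rw [le_mk_iff]
  constructor
  · rintro ⟨A', hA', h⟩
    obtain ⟨g, hg⟩ := mk_eq_mk.1 hA'.symm
    exact ⟨g, hg.le.trans h⟩
  · rintro ⟨g, hg⟩
    obtain ⟨A', hA'⟩ := conj_mem g A
    exact ⟨A', (mk_eq_mk.2 ⟨g, hA'.symm⟩).symm, hA'.le.trans hg⟩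

theorem rk_eq_of_mk_eq {A B : ProperFreeFactor n} (h : mk A = mk B) :
    ProperFreeFactor.rk A = ProperFreeFactor.rk B := by
  obtain ⟨g, hg⟩ := mk_eq_mk.1 h
  obtain ⟨b, S, rfl⟩ := exists_std A
  have h1 : B = std (b.map (MulAut.conj g)) S :=
    Subtype.ext (hg.symm.trans (b.span_map _ _).symm)
  rw [h1, rk_std, rk_std]

theorem mk_mem_OFRank_iff {A : ProperFreeFactor n} {i : ℕ} :
    mk A ∈ OFRank n i ↔ ProperFreeFactor.rk A = i := by
  constructor
  · rintro ⟨B, hB, h⟩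
    rw [← rk_eq_of_mk_eq h]
    exact mem_AFRank_iff.1 hB
  · intro h
    exact ⟨A, mem_AFRank_iff.2 h, rfl⟩

/-- The rank of a conjugacy class of free factors. -/
noncomputable def rk (a : FreeFactorClass n) : ℕ := sInf {i | a ∈ OFRank n i}

theorem rk_mk (A : ProperFreeFactor n) : rk (mk A) = ProperFreeFactor.rk A := by
  simp only [rk, mk_mem_OFRank_iff]
  simp

theorem mem_OFRank_iff {a : FreeFactorClass n} {i : ℕ} : a ∈ OFRank n i ↔ rk a = i := by
  obtain ⟨A, rfl⟩ := exists_mk a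
  rw [mk_mem_OFRank_iff, rk_mk]

theorem mk_std_le_iff (b : FreeGroupBasis (Fin n) (FreeGroup (Fin n))) (S T : ProperSubset n) :
    mk (std b S) ≤ mk (std b T) ↔ S.1 ⊆ T.1 := by
  constructor
  · intro h
    obtain ⟨g, hg⟩ := mk_le_mk_iff.1 h
    exact Finset.coe_subset.1 (b.subset_of_conj_span_le hg)
  · intro h
    exact le_mk_iff.2 ⟨_, rfl, (std_le_iff b S T).2 h⟩

/-- The ordered set of conjugacy classes of free factors, with the frames given by the bases of the
free group. -/
noncomputable def framedOrder (hn : 3 ≤ n) : FramedOrder (FreeFactorClass n) n where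
  Frame := FreeGroupBasis (Fin n) (FreeGroup (Fin n))
  rk := rk
  std b S := mk (std b S)
  rk_std b S := by rw [rk_mk, rk_std]
  std_le_iff := mk_std_le_iff
  adapted a c h := by
    obtain ⟨A, B, rfl, rfl, hAB⟩ := h
    obtain ⟨b, S, T, rfl, rfl⟩ := exists_std_of_le hAB
    exact ⟨b, S, T, rfl, rfl⟩
  joins L hL := by
    obtain ⟨L, rfl⟩ := exists_mk L
    rw [rk_mk] at hL
    obtain ⟨b, j, rfl⟩ := exists_eq_cosingle hn hL
    refine ⟨mk (std b (FramedOrder.single hn j)), by simp [rk_mk, rk_std, FramedOrder.single], ?_,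
      fun q hq hqL => ?_⟩
    · simp [mk_std_le_iff, FramedOrder.single, FramedOrder.cosingle]
    · obtain ⟨q, rfl, hqL'⟩ := le_mk_iff.1 hqL
      rw [rk_mk] at hq
      obtain ⟨C, hC, h1, h2⟩ := exists_join hn b j hq hqL'
      exact ⟨mk C, by rw [rk_mk, hC], ⟨_, _, rfl, rfl, h1⟩, ⟨_, _, rfl, rfl, h2⟩⟩
  transverse L p hL hp hpL := by
    obtain ⟨L, rfl⟩ := exists_mk L
    obtain ⟨p, rfl⟩ := exists_mk p
    rw [rk_mk] at hL hp
    obtain ⟨a, j, rfl⟩ := exists_eq_cosingle hn hL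
    obtain ⟨b, k, rfl⟩ := exists_eq_single hn hp
    obtain ⟨d, i, hik, hdk, -, h⟩ := FreeGroupBasis.exists_transverse hn a b j k
    refine ⟨mk (std d (FramedOrder.cosingle hn i)), by simp [rk_mk, rk_std, FramedOrder.cosingle,
      Finset.card_compl], ⟨_, _, rfl, rfl, ?_⟩, fun K hK hKM hKL => ?_⟩
    · change (std b _).1 ≤ (std d _).1
      rw [coe_std_single, coe_std_cosingle, b.span_le]
      rintro _ rfl
      rw [← hdk]
      exact d.mem_span (by simpa using Ne.symm hik)
    · obtain ⟨K, rfl, hKM'⟩ := le_mk_iff.1 hKM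
      obtain ⟨g, hg⟩ := mk_le_mk_iff.1 hKL
      obtain ⟨e, S, rfl⟩ := exists_std K
      rw [rk_mk, rk_std] at hK
      refine h (fun g hb => hpL (mk_le_mk_iff.2 ⟨g, ?_⟩)) e S.1 (by omega)
        (by rw [← coe_std_cosingle hn]; exact hKM') g (by rw [← coe_std_cosingle hn]; exact hg)
      rw [coe_std_single, coe_std_cosingle, Subgroup.map_le_iff_le_comap, b.span_le]
      rintro _ rfl
      exact hb

end FreeFactorClass

/-! ### Automorphisms preserve ranks -/

theorem mainTheorem5 (n : ℕ) :
    (∀ φ ∈ simplicialAut (AF n), ∀ i : ℕ, 1 ≤ i → i < n → φ '' AFRank n i = AFRank n i) ∧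
    (∀ φ ∈ simplicialAut (OF n), ∀ i : ℕ, 1 ≤ i → i < n → φ '' OFRank n i = OFRank n i) := by
  have aux : ∀ {P : Type} (φ : Equiv.Perm P) (rk : P → ℕ) (s : Set P) (i : ℕ),
      (∀ a, a ∈ s ↔ rk a = i) → (∀ a, rk (φ a) = rk a) → φ '' s = s := by
    intro P φ rk s i hs hφ
    rw [Equiv.image_eq_preimage_symm]
    ext a
    rw [Set.mem_preimage, hs, hs, ← hφ, φ.apply_symm_apply]
  -- For `n ≤ 2` there is at most one rank, and nothing is left to distinguish.
  have two : ¬ 3 ≤ n → ∀ i, 1 ≤ i → i < n → ∀ m, 1 ≤ m → m < n → m = i := by omega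
  constructor
  · intro φ hφ i h1 hi
    refine aux φ ProperFreeFactor.rk _ i (fun _ => ProperFreeFactor.mem_AFRank_iff) fun a => ?_
    by_cases hn : 3 ≤ n
    · exact (ProperFreeFactor.framedOrder hn).rk_eq_of_comparability
        (comparability_of_mem_simplicialAut hφ) hn a
    · exact two hn _ a.rk_pos a.rk_lt _ (ProperFreeFactor.rk_pos _) (ProperFreeFactor.rk_lt _)
  · intro φ hφ i h1 hi
    refine aux φ FreeFactorClass.rk _ i (fun _ => FreeFactorClass.mem_OFRank_iff) fun a => ?_
    by_cases hn : 3 ≤ n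
    · exact (FreeFactorClass.framedOrder hn).rk_eq_of_comparability
        (comparability_of_mem_simplicialAut hφ) hn a
    · obtain ⟨B, hB⟩ := FreeFactorClass.exists_mk (φ a)
      obtain ⟨A, rfl⟩ := FreeFactorClass.exists_mk a
      rw [← hB, FreeFactorClass.rk_mk, FreeFactorClass.rk_mk]
      exact two hn _ A.rk_pos A.rk_lt _ B.rk_pos B.rk_lt
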